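/- For a Markov kernel $\pi$ on a measurable space $\mathbf X$ put $$\delta(\pi)=\sup_{x_1,x_2\in\mathbf X,\ A\ \text{measurable}}|\pi(x_1,A)-\pi(x_2,A)|,\qquad \alpha(\pi)=1-\delta(\pi).$$ For every $n\ge 1$ let $X^{(n)}_1,\dots,X^{(n)}_n$ be a (possibly time-inhomogeneous) Markov chain in $\mathbf X$, on its own probability space, with initial distribution $\mu^{(n)}$ and transition kernels $\pi^{(n)}_{i,i+1}$, $1\le i\le n-1$, and put $\pi^{(n)}_{i,i+2}=\pi^{(n)}_{i,i+1}\pi^{(n)}_{i+1,i+2}$, $$\alpha_n=\min_{1\le i\le n-1}\alpha(\pi^{(n)}_{i,i+1}),\qquad \alpha^{(2)}_n=\min_{1\le i\le n-2}\alpha(\pi^{(n)}_{i,i+2}).$$ Let $f^{(n)}_i:\mathbf X\to\mathbb R$, $1\le i\le n$, be measurable, and $S_n=\sum_{i=1}^n f^{(n)}_i(X^{(n)}_i)$. Consider the following hypotheses: (a) $\sup_{1\le i\le n}\sup_{x\in\mathbf X}|f^{(n)}_i(x)|\le C_n$ for every $n\ge1$, with $\sup_n C_n<\infty$; (b) $\mathbb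 D\bigl(f^{(n)}_i(X^{(n)}_i)\bigr)\ge c>0$ for all $n\ge 1$ and $1\le i\le n$, with $c$ independent of $i$ and $n$; (c) $\lim_{n\to\infty} n\,\alpha_n\,(\alpha^{(2)}_n)^2=\infty$. 1. If (a), (b) and (c) hold, then the central limit theorem holds: $$\frac{S_n-\mathbb E S_n}{\sqrt{\mathbb D(S_n)}}\Longrightarrow\mathcal N(0,1)\qquad(n\to\infty)$$ (weak convergence). 2. Dobrushin's condition $\lim_{n\to\infty} n^{1/3}\alpha_n=\infty$ may fail under these hypotheses: for every $k\ge 4$ there are a triangular array of Markov chains on a $k$-point space, time-homogeneous for each $n$ (that is, $\pi^{(n)}_{i,i+1}$ does not depend on $i$), and functions $f^{(n)}_i$, satisfying (a), (b) and (c), for which $n^{1/3}\alpha_n$ converges to a finite positive limit, so that $n^{1/3}\alpha_n\not\to\infty$. -/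

import Mathlib

open MeasureTheory ProbabilityTheory Filter Topology

noncomputable section

/-- The process `X 1, …, X n` on the probability space `(Ω, P)` is a (possibly time-inhomogeneous)
Markov chain of length `n` in the measurable space `S`, with initial distribution `μ` and one-step
transition kernels `κ i`, `1 ≤ i ≤ n - 1` (from time `i` to time `i + 1`):
`P (X (i+1) ∈ A | X 1, …, X i) = κ i (X i, A)` almost surely, for every measurable `A`. -/
structure IsMarkovChain {Ω S : Type*} [MeasurableSpace Ω] [MeasurableSpace S]
    (P : Measure Ω) (n : ℕ) (μ : Measure S) (κ : ℕ → Kernel S S) (X : ℕ → Ω → S) : Prop where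
  measurable : ∀ i ∈ Finset.Icc 1 n, Measurable (X i)
  initial : P.map (X 1) = μ
  transition : ∀ i, 1 ≤ i → i + 1 ≤ n → ∀ A : Set S, MeasurableSet A →
    P[(X (i + 1) ⁻¹' A).indicator (fun _ => (1 : ℝ)) |
        ⨆ j ∈ Finset.Icc 1 i, MeasurableSpace.comap (X j) inferInstance]
      =ᵐ[P] fun ω => (κ i (X i ω)).real A

/-- The Markov–Dobrushin coefficient
`δ(κ) = sup { |κ(x₁, A) - κ(x₂, A)| : x₁, x₂ ∈ S, A measurable }`. -/
def mdDelta {S : Type*} [MeasurableSpace S] (κ : Kernel S S) : ℝ :=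
  ⨆ q : S × S × {A : Set S // MeasurableSet A},
    |(κ q.1).real q.2.2 - (κ q.2.1).real q.2.2|

/-- `α(κ) = 1 - δ(κ)`. -/
def mdAlpha {S : Type*} [MeasurableSpace S] (κ : Kernel S S) : ℝ := 1 - mdDelta κ

/-- `α_n`: the minimum over `1 ≤ i ≤ n - 1` of `α` of the one-step kernel from `i` to `i + 1`
(meaningful for `n ≥ 2`). -/
def alphaOne {S : Type*} [MeasurableSpace S] (n : ℕ) (κ : ℕ → Kernel S S) : ℝ :=
  ⨅ i : Set.Icc 1 (n - 1), mdAlpha (κ i)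

/-- `α_n^{(2)}`: the minimum over `1 ≤ i ≤ n - 2` of `α` of the two-step kernel from `i` to `i + 2`
(meaningful for `n ≥ 3`). -/
def alphaTwo {S : Type*} [MeasurableSpace S] (n : ℕ) (κ : ℕ → Kernel S S) : ℝ :=
  ⨅ i : Set.Icc 1 (n - 2), mdAlpha (κ ((i : ℕ) + 1) ∘ₖ κ i)

/-- `S_n = f 1 (X 1) + ⋯ + f n (X n)`. -/
def chainSum {Ω S : Type*} (n : ℕ) (f : ℕ → S → ℝ) (X : ℕ → Ω → S) (ω : Ω) : ℝ :=
  ∑ i ∈ Finset.Icc 1 n, f i (X i ω)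

end

/-! Center the functions and let T_k(x) be the conditional expectation of the sum of f_i(X_i) over i
> k given X_k = x. Then M_k = Σ_{i≤k} f_i(X_i) + T_k(X_k) is a martingale leading from 0 to the
centered S_n. Expanding T_k two steps at a time gives a geometric series of ratio 1 - α⁽²⁾, so T_k
and the increments of M are O(1/α⁽²⁾) (`osc_tailSum_le`). The conditional second moment of a future
sum is again a conditional future sum, now of f_i² + 2 f_i T_i; a second use of the same bound shows
that the conditional future variance R_k, a function of X_k, oscillates by only O(1/(α⁽²⁾)²)
(`osc_tailVar`).

A transition with coefficient δ contracts variances by the factor δ (`integral_kerMean_sq_le`), and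
this yields V = Var S_n ≥ n α_n c / 4 (`le_integral_tailVar`). After division by √V, respectively V,
the increments of M are at most η and the oscillations of R at most η², where η² is of order 1/(n
α_n (α⁽²⁾)²) and tends to 0 by (c).

For such a martingale the expectation of exp(i t M_k - t² R_k / 2) is almost constant in k. It is
close to exp(-t²/2) at k = 0 and equals the characteristic function at k = n. The first- and
second-order terms of each increment vanish by conditioning; the remainders sum to O(η) because Σ
E(ΔM)² = 1 and Σ E(ΔR)² ≤ 3η². Since R is almost deterministic, no law of large numbers for squared
increments is needed.

For part 2, a state is a pair of bits. The last bit is copied into the first place, flipped with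
probability p/2, and a fresh fair bit is appended. One step remembers the old last bit, so α = p;
two steps forget everything, so α⁽²⁾ = 1. The choice p = n^(-1/3) gives n α_n (α⁽²⁾)² = n^(2/3). -/

set_option linter.unusedSectionVars false

/-! ### Bounded test functions. -/

/-- Bounded measurable real functions. -/
def BddMeas {Ω : Type*} [MeasurableSpace Ω] (f : Ω → ℝ) : Prop :=
  Measurable f ∧ ∃ C, ∀ ω, |f ω| ≤ C

namespace BddMeas

variable {Ω : Type*} [MeasurableSpace Ω] {f g : Ω → ℝ}

lemma const (c : ℝ) : BddMeas (fun _ : Ω => c) := ⟨measurable_const, |c|, fun _ => le_rfl⟩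

lemma add (hf : BddMeas f) (hg : BddMeas g) : BddMeas (fun ω => f ω + g ω) := by
  obtain ⟨hf, C, hC⟩ := hf
  obtain ⟨hg, D, hD⟩ := hg
  exact ⟨hf.add hg, C + D, fun ω => (abs_add_le _ _).trans (add_le_add (hC ω) (hD ω))⟩

lemma mul (hf : BddMeas f) (hg : BddMeas g) : BddMeas (fun ω => f ω * g ω) := by
  obtain ⟨hf, C, hC⟩ := hf
  obtain ⟨hg, D, hD⟩ := hg
  refine ⟨hf.mul hg, C * D, fun ω => ?_⟩
  rw [abs_mul]
  exact mul_le_mul (hC ω) (hD ω) (abs_nonneg _) ((abs_nonneg _).trans (hC ω))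

lemma neg (hf : BddMeas f) : BddMeas (fun ω => -f ω) := by
  simpa using (const (-1)).mul hf

lemma sub (hf : BddMeas f) (hg : BddMeas g) : BddMeas (fun ω => f ω - g ω) := by
  simpa [sub_eq_add_neg] using hf.add hg.neg

lemma sq (hf : BddMeas f) : BddMeas (fun ω => f ω ^ 2) := by
  simpa [pow_two] using hf.mul hf

lemma sum {ι : Type*} (s : Finset ι) {f : ι → Ω → ℝ} (h : ∀ i ∈ s, BddMeas (f i)) :
    BddMeas (fun ω => ∑ i ∈ s, f i ω) := by
  classical
  induction s using Finset.induction_on with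
  | empty => simpa using const 0
  | insert a s ha ih =>
    simp only [Finset.sum_insert ha]
    exact (h a (by simp)).add (ih fun i hi => h i (by simp [hi]))

lemma comp {S : Type*} [MeasurableSpace S] {f : S → ℝ} (hf : BddMeas f) {X : Ω → S}
    (hX : Measurable X) : BddMeas (fun ω => f (X ω)) :=
  ⟨hf.1.comp hX, hf.2.imp fun _ h ω => h (X ω)⟩

lemma integrable (hf : BddMeas f) (P : Measure Ω) [IsFiniteMeasure P] : Integrable f P := by
  obtain ⟨hf, C, hC⟩ := hf
  exact Integrable.of_bound hf.aestronglyMeasurable C (Eventually.of_forall hC)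

lemma mono {Ω : Type*} {m m' : MeasurableSpace Ω} (hm : m ≤ m') {f : Ω → ℝ}
    (hf : @BddMeas Ω m f) : @BddMeas Ω m' f :=
  ⟨hf.1.mono hm le_rfl, hf.2⟩

end BddMeas

/-- Orthogonality to bounded real functions extends to bounded complex functions. -/
lemma integral_complex_mul_eq_zero {Ω : Type*} {m m0 : MeasurableSpace Ω} (hm : m ≤ m0)
    (P : Measure Ω) [IsFiniteMeasure P] {Y : Ω → ℝ} (hY : BddMeas Y)
    (h : ∀ U : Ω → ℝ, @BddMeas Ω m U → ∫ ω, U ω * Y ω ∂P = 0)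
    {U : Ω → ℂ} (hU : Measurable[m] U) {C : ℝ} (hC : ∀ ω, ‖U ω‖ ≤ C) :
    ∫ ω, U ω * (Y ω : ℂ) ∂P = 0 := by
  have hre : @BddMeas Ω m fun ω => (U ω).re :=
    ⟨Complex.measurable_re.comp hU, C, fun ω => (Complex.abs_re_le_norm _).trans (hC ω)⟩
  have him : @BddMeas Ω m fun ω => (U ω).im :=
    ⟨Complex.measurable_im.comp hU, C, fun ω => (Complex.abs_im_le_norm _).trans (hC ω)⟩
  have e : ∀ ω, U ω * (Y ω : ℂ)
      = (((U ω).re * Y ω : ℝ) : ℂ) + (((U ω).im * Y ω : ℝ) : ℂ) * Complex.I := by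
    intro ω
    conv_lhs => rw [← Complex.re_add_im (U ω)]
    push_cast
    ring
  simp_rw [e]
  rw [integral_add, integral_mul_const, integral_complex_ofReal, integral_complex_ofReal, h _ hre,
    h _ him]
  · simp
  · exact (((hre.mono hm).mul hY).integrable P).ofReal
  · exact (((him.mono hm).mul hY).integrable P).ofReal.mul_const _

lemma norm_exp_sub_taylor_two_le {z : ℂ} (hz : ‖z‖ ≤ 1) :
    ‖Complex.exp z - 1 - z - z ^ 2 / 2‖ ≤ ‖z‖ ^ 3 := by
  have h := Complex.exp_bound hz (n := 3) (by norm_num)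
  have e : ∑ m ∈ Finset.range 3, z ^ m / (m.factorial : ℂ) = 1 + z + z ^ 2 / 2 := by
    simp [Finset.sum_range_succ]
  rw [e] at h
  calc ‖Complex.exp z - 1 - z - z ^ 2 / 2‖ = ‖Complex.exp z - (1 + z + z ^ 2 / 2)‖ := by
        congr 1; ring
    _ ≤ _ := h
    _ ≤ ‖z‖ ^ 3 * 1 := by
        gcongr
        norm_num [Nat.factorial]
    _ = _ := mul_one _

/-! ### Martingales with almost deterministic conditional variance. -/

/-- A martingale `M` on `0, …, n` started at `0`, with increments at most `η`, together with its
conditional future variances `R`, normalized by `E R₀ = 1`, each oscillating by at most `η ^ 2`. -/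
structure IsAlmostNormalMartingale {Ω : Type*} [m0 : MeasurableSpace Ω] (P : Measure Ω) (n : ℕ)
    (F : ℕ → MeasurableSpace Ω) (M R : ℕ → Ω → ℝ) (η : ℝ) : Prop where
  le : ∀ k ≤ n, F k ≤ m0
  bddMeas_M : ∀ k ≤ n, @BddMeas Ω (F k) (M k)
  bddMeas_R : ∀ k ≤ n, @BddMeas Ω (F k) (R k)
  M_zero : ∀ ω, M 0 ω = 0
  R_last : ∀ ω, R n ω = 0
  R_nonneg : ∀ k ≤ n, ∀ ω, 0 ≤ R k ω
  increment : ∀ k < n, ∀ ω, |M (k + 1) ω - M k ω| ≤ η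
  osc : ∀ k ≤ n, ∀ ω ω', |R k ω - R k ω'| ≤ η ^ 2
  integral_R : ∫ ω, R 0 ω ∂P = 1
  mart : ∀ k < n, ∀ U : Ω → ℝ, @BddMeas Ω (F k) U →
    ∫ ω, U ω * (M (k + 1) ω - M k ω) ∂P = 0
  var : ∀ k < n, ∀ U : Ω → ℝ, @BddMeas Ω (F k) U →
    ∫ ω, U ω * ((M (k + 1) ω - M k ω) ^ 2 + R (k + 1) ω - R k ω) ∂P = 0

lemma abs_sub_integral_le_of_osc {Ω : Type*} [MeasurableSpace Ω] (P : Measure Ω)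
    [IsProbabilityMeasure P] {g : Ω → ℝ} (hg : Integrable g P) {ε : ℝ}
    (h : ∀ ω ω', |g ω - g ω'| ≤ ε) (ω : Ω) : |g ω - ∫ ω', g ω' ∂P| ≤ ε := by
  have e : g ω - ∫ ω', g ω' ∂P = ∫ ω', (g ω - g ω') ∂P := by
    rw [integral_sub (integrable_const _) hg]; simp
  rw [e]
  have := norm_integral_le_of_norm_le_const (μ := P) (f := fun ω' => g ω - g ω') (C := ε)
    (Eventually.of_forall fun ω' => h ω ω')
  simpa using this

namespace IsAlmostNormalMartingale

variable {Ω : Type*} [MeasurableSpace Ω] {P : Measure Ω} [IsProbabilityMeasure P] {n : ℕ}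
  {F : ℕ → MeasurableSpace Ω} {M R : ℕ → Ω → ℝ} {η : ℝ}

lemma bdd_M (h : IsAlmostNormalMartingale P n F M R η) {k : ℕ} (hk : k ≤ n) : BddMeas (M k) :=
  (h.bddMeas_M k hk).mono (h.le k hk)

lemma bdd_R (h : IsAlmostNormalMartingale P n F M R η) {k : ℕ} (hk : k ≤ n) : BddMeas (R k) :=
  (h.bddMeas_R k hk).mono (h.le k hk)

lemma bdd_inc (h : IsAlmostNormalMartingale P n F M R η) {k : ℕ} (hk : k < n) :
    BddMeas (fun ω => M (k + 1) ω - M k ω) :=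
  (h.bdd_M hk).sub (h.bdd_M hk.le)

lemma bdd_incR (h : IsAlmostNormalMartingale P n F M R η) {k : ℕ} (hk : k < n) :
    BddMeas (fun ω => R (k + 1) ω - R k ω) :=
  (h.bdd_R hk).sub (h.bdd_R hk.le)

lemma integral_inc_sq (h : IsAlmostNormalMartingale P n F M R η) {k : ℕ} (hk : k < n) :
    ∫ ω, (M (k + 1) ω - M k ω) ^ 2 ∂P = ∫ ω, R k ω ∂P - ∫ ω, R (k + 1) ω ∂P := by
  have := h.var k hk (fun _ => 1) (@BddMeas.const _ (F k) 1)
  simp only [one_mul] at this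
  rw [integral_sub, integral_add] at this
  · linarith
  · exact (h.bdd_inc hk).sq.integrable P
  · exact (h.bdd_R hk).integrable P
  · exact ((h.bdd_inc hk).sq.add (h.bdd_R hk)).integrable P
  · exact (h.bdd_R hk.le).integrable P

lemma sum_integral_inc_sq (h : IsAlmostNormalMartingale P n F M R η) :
    ∑ k ∈ Finset.range n, ∫ ω, (M (k + 1) ω - M k ω) ^ 2 ∂P = 1 := by
  rw [Finset.sum_congr rfl fun k hk => h.integral_inc_sq (Finset.mem_range.1 hk),
    Finset.sum_range_sub' (fun k => ∫ ω, R k ω ∂P), h.integral_R]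
  simp [h.R_last]

lemma integral_inc_sq_le (h : IsAlmostNormalMartingale P n F M R η) {k : ℕ} (hk : k < n) :
    ∫ ω, (M (k + 1) ω - M k ω) ^ 2 ∂P ≤ η ^ 2 := by
  have := integral_mono ((h.bdd_inc hk).sq.integrable P) (integrable_const (η ^ 2))
    (fun ω => sq_le_sq' (abs_le.1 (h.increment k hk ω)).1 (abs_le.1 (h.increment k hk ω)).2)
  simpa using this

/-- Each `R k` is within η² of its mean, and consecutive means differ by the mean of a squared
increment, at most η². -/
lemma abs_incR_le (h : IsAlmostNormalMartingale P n F M R η) {k : ℕ} (hk : k < n) (ω : Ω) :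
    |R (k + 1) ω - R k ω| ≤ 3 * η ^ 2 := by
  have h1 := abs_le.1 (abs_sub_integral_le_of_osc P ((h.bdd_R hk).integrable P) (h.osc _ hk) ω)
  have h2 := abs_le.1
    (abs_sub_integral_le_of_osc P ((h.bdd_R hk.le).integrable P) (h.osc _ hk.le) ω)
  have h3 := h.integral_inc_sq hk
  have h4 := h.integral_inc_sq_le hk
  have h5 : 0 ≤ ∫ ω, (M (k + 1) ω - M k ω) ^ 2 ∂P := integral_nonneg fun _ => sq_nonneg _
  rw [abs_le]
  constructor <;> linarith [h1.1, h1.2, h2.1, h2.2]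

/-- The right side is made to telescope. With r_k = E R_k and x = E(ΔM)² = r_k - r_{k+1}, one has 2
r_k x = r_k² - r_{k+1}² + x². The errors x² ≤ η² x and 2 η² x make up the last term. -/
lemma integral_incR_sq_le (h : IsAlmostNormalMartingale P n F M R η) {k : ℕ} (hk : k < n) :
    ∫ ω, (R (k + 1) ω - R k ω) ^ 2 ∂P ≤ (∫ ω, R (k + 1) ω ^ 2 ∂P - ∫ ω, R k ω ^ 2 ∂P)
      + ((∫ ω, R k ω ∂P) ^ 2 - (∫ ω, R (k + 1) ω ∂P) ^ 2)
      + 3 * η ^ 2 * ∫ ω, (M (k + 1) ω - M k ω) ^ 2 ∂P := by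
  have b1 := h.bdd_R hk
  have b0 := h.bdd_R hk.le
  have bi := (h.bdd_inc hk).sq
  have e : ∫ ω, (R (k + 1) ω - R k ω) ^ 2 ∂P = ∫ ω, R (k + 1) ω ^ 2 ∂P - ∫ ω, R k ω ^ 2 ∂P
      + 2 * ∫ ω, R k ω * (M (k + 1) ω - M k ω) ^ 2 ∂P := by
    -- Testing `var` against `R k` itself replaces `R k * (R k - R (k + 1))` by `R k * (ΔM)²` under
    -- the integral.
    have hv := h.var k hk (R k) (h.bddMeas_R k hk.le)
    rw [← integral_const_mul, ← integral_sub (b1.sq.integrable P) (b0.sq.integrable P),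
      ← integral_add ((b1.sq.sub b0.sq).integrable P)
        (((BddMeas.const 2).mul (b0.mul bi)).integrable P), ← sub_eq_zero,
      ← integral_sub ((b1.sub b0).sq.integrable P)
        (((b1.sq.sub b0.sq).add ((BddMeas.const 2).mul (b0.mul bi))).integrable P)]
    rw [← mul_zero (-2 : ℝ), ← hv, ← integral_const_mul]
    congr 1
    ext ω
    ring
  have hle : ∫ ω, R k ω * (M (k + 1) ω - M k ω) ^ 2 ∂P
      ≤ (∫ ω, R k ω ∂P + η ^ 2) * ∫ ω, (M (k + 1) ω - M k ω) ^ 2 ∂P := by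
    rw [← integral_const_mul]
    refine integral_mono ((b0.mul bi).integrable P)
      (((BddMeas.const _).mul bi).integrable P) fun ω => ?_
    refine mul_le_mul_of_nonneg_right ?_ (sq_nonneg _)
    have := (abs_le.1 (abs_sub_integral_le_of_osc P (b0.integrable P) (h.osc _ hk.le) ω)).2
    linarith
  have h3 := h.integral_inc_sq hk
  have h4 := h.integral_inc_sq_le hk
  have h5 : 0 ≤ ∫ ω, (M (k + 1) ω - M k ω) ^ 2 ∂P := integral_nonneg fun _ => sq_nonneg _
  have h6 : (∫ ω, (M (k + 1) ω - M k ω) ^ 2 ∂P) ^ 2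
      ≤ η ^ 2 * ∫ ω, (M (k + 1) ω - M k ω) ^ 2 ∂P := by
    rw [sq]; exact mul_le_mul_of_nonneg_right h4 h5
  have h7 : ∫ ω, R (k + 1) ω ∂P = ∫ ω, R k ω ∂P - ∫ ω, (M (k + 1) ω - M k ω) ^ 2 ∂P := by
    linarith
  rw [e, h7]
  nlinarith

/-- After telescoping, what is left besides 3η² is minus the variance of `R 0`. -/
lemma sum_integral_incR_sq_le (h : IsAlmostNormalMartingale P n F M R η) :
    ∑ k ∈ Finset.range n, ∫ ω, (R (k + 1) ω - R k ω) ^ 2 ∂P ≤ 3 * η ^ 2 := by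
  refine (Finset.sum_le_sum fun k hk => h.integral_incR_sq_le (Finset.mem_range.1 hk)).trans ?_
  rw [Finset.sum_add_distrib, Finset.sum_add_distrib, ← Finset.mul_sum, h.sum_integral_inc_sq,
    Finset.sum_range_sub (fun k => ∫ ω, R k ω ^ 2 ∂P),
    Finset.sum_range_sub' (fun k => (∫ ω, R k ω ∂P) ^ 2), h.integral_R]
  simp only [h.R_last]
  have hv := variance_nonneg (R 0) P
  rw [variance_eq_sub (by
    obtain ⟨hm, C, hC⟩ := h.bdd_R (Nat.zero_le n)
    exact MemLp.of_bound hm.aestronglyMeasurable C (Eventually.of_forall hC)), h.integral_R] at hv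
  have : P[R 0 ^ 2] = ∫ ω, R 0 ω ^ 2 ∂P := rfl
  rw [this] at hv
  simp
  linarith

/-- The interpolating exponential. -/
noncomputable def phase (M R : ℕ → Ω → ℝ) (t : ℝ) (k : ℕ) (ω : Ω) : ℂ :=
  Complex.exp ((t * M k ω : ℝ) * Complex.I - (t ^ 2 * R k ω / 2 : ℝ))

lemma measurable_phase (h : IsAlmostNormalMartingale P n F M R η) (t : ℝ) {k : ℕ} (hk : k ≤ n) :
    Measurable[F k] (phase M R t k) := by
  have hc : Measurable fun p : ℝ × ℝ =>
      Complex.exp ((t * p.1 : ℝ) * Complex.I - (t ^ 2 * p.2 / 2 : ℝ)) := by fun_prop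
  exact hc.comp ((h.bddMeas_M k hk).1.prodMk (h.bddMeas_R k hk).1)

lemma norm_phase_le (h : IsAlmostNormalMartingale P n F M R η) (t : ℝ) {k : ℕ} (hk : k ≤ n)
    (ω : Ω) : ‖phase M R t k ω‖ ≤ 1 := by
  unfold phase
  rw [Complex.norm_exp]
  simp only [Complex.sub_re, Complex.mul_re, Complex.ofReal_re, Complex.I_re, mul_zero,
    Complex.ofReal_im, Complex.I_im, mul_one, sub_self, zero_sub, Real.exp_le_one_iff]
  have := h.R_nonneg k hk ω
  have : 0 ≤ t ^ 2 * R k ω := by positivity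
  linarith

lemma integrable_phase (h : IsAlmostNormalMartingale P n F M R η) (t : ℝ) {k : ℕ} (hk : k ≤ n) :
    Integrable (phase M R t k) P :=
  Integrable.of_bound ((h.measurable_phase t hk).mono (h.le k hk) le_rfl).aestronglyMeasurable 1
    (Eventually.of_forall (h.norm_phase_le t hk))

end IsAlmostNormalMartingale

namespace IsAlmostNormalMartingale

variable {Ω : Type*} [MeasurableSpace Ω] {P : Measure Ω} [IsProbabilityMeasure P] {n : ℕ}
  {F : ℕ → MeasurableSpace Ω} {M R : ℕ → Ω → ℝ} {η : ℝ}

/-- The two terms taken off the increment of `phase` are exactly those whose expectation vanishes by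
`mart` and `var`; the rest is of third order, counting ΔR as of order (ΔM)². -/
lemma phase_succ_sub_remainder (t : ℝ) (k : ℕ) (ω : Ω) {L : ℝ} (hη : 0 < η) (hL : L ≤ 1)
    (hz : |t| * |M (k + 1) ω - M k ω| + t ^ 2 * |R (k + 1) ω - R k ω| / 2 ≤ L)
    (hU : ‖phase M R t k ω‖ ≤ 1) :
    ‖phase M R t (k + 1) ω - phase M R t k ω
      - Complex.I * t * (phase M R t k ω * (M (k + 1) ω - M k ω : ℝ))
      + t ^ 2 / 2 * (phase M R t k ω *
          ((M (k + 1) ω - M k ω) ^ 2 + R (k + 1) ω - R k ω : ℝ))‖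
      ≤ (|t| ^ 3 * η / 4 + L * t ^ 2) * (M (k + 1) ω - M k ω) ^ 2
        + (|t| ^ 3 / (4 * η) + t ^ 4 / 8 + L * t ^ 4 / 4) * (R (k + 1) ω - R k ω) ^ 2 := by
  set U := phase M R t k ω with hUdef
  have hs : phase M R t (k + 1) ω = U * Complex.exp
      ((t * (M (k + 1) ω - M k ω) : ℝ) * Complex.I
        - (t ^ 2 * (R (k + 1) ω - R k ω) / 2 : ℝ)) := by
    rw [hUdef, phase, phase, ← Complex.exp_add]
    congr 1
    push_cast
    ring
  have ha : ((M (k + 1) ω - M k ω) ^ 2 + R (k + 1) ω - R k ω : ℝ)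
      = (M (k + 1) ω - M k ω) ^ 2 + (R (k + 1) ω - R k ω) := by ring
  rw [hs, ha]
  generalize M (k + 1) ω - M k ω = x at *
  generalize R (k + 1) ω - R k ω = q at *
  set z : ℂ := (t * x : ℝ) * Complex.I - (t ^ 2 * q / 2 : ℝ) with hzdef
  have hzn : ‖z‖ ≤ L := by
    refine le_trans ?_ hz
    refine (norm_sub_le _ _).trans ?_
    rw [norm_mul, Complex.norm_I, mul_one, Complex.norm_real, Complex.norm_real, Real.norm_eq_abs,
      Real.norm_eq_abs, abs_mul, abs_div, abs_mul, abs_of_nonneg (sq_nonneg t), abs_two]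
  have hzsq : ‖z‖ ^ 2 = t ^ 2 * x ^ 2 + t ^ 4 * q ^ 2 / 4 := by
    rw [← Complex.normSq_eq_norm_sq, Complex.normSq_apply]
    simp only [hzdef, Complex.sub_re, Complex.mul_re, Complex.ofReal_re, Complex.I_re, mul_zero,
      Complex.ofReal_im, Complex.I_im, mul_one, sub_self, zero_sub, Complex.sub_im, Complex.mul_im,
      add_zero, sub_zero]
    ring
  -- Here z = i t x - t² q / 2, so of z + z²/2 only the mixed term in x q and the term in q²
  -- survive.
  have e : U * Complex.exp z - U - Complex.I * t * (U * (x : ℝ))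
      + t ^ 2 / 2 * (U * (x ^ 2 + q : ℝ))
      = U * ((Complex.exp z - 1 - z - z ^ 2 / 2)
        + ((-(t ^ 3 * x * q / 2) : ℝ) * Complex.I + (t ^ 4 * q ^ 2 / 8 : ℝ))) := by
    rw [hzdef]
    push_cast
    ring_nf
    rw [Complex.I_sq]
    ring
  rw [e, norm_mul]
  have h3 : ‖z‖ ^ 3 ≤ L * (t ^ 2 * x ^ 2 + t ^ 4 * q ^ 2 / 4) := by
    rw [← hzsq, pow_succ, mul_comm]
    exact mul_le_mul_of_nonneg_right hzn (by positivity)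
  have h4 : ‖((-(t ^ 3 * x * q / 2) : ℝ) * Complex.I + (t ^ 4 * q ^ 2 / 8 : ℝ))‖
      ≤ |t| ^ 3 * (|x| * |q|) / 2 + t ^ 4 * q ^ 2 / 8 := by
    refine (norm_add_le _ _).trans ?_
    rw [norm_mul, Complex.norm_I, mul_one, Complex.norm_real, Complex.norm_real, Real.norm_eq_abs,
      Real.norm_eq_abs, abs_neg, abs_div, abs_mul, abs_mul, abs_pow, abs_two,
      abs_of_nonneg (by positivity : 0 ≤ t ^ 4 * q ^ 2 / 8), mul_assoc]
  -- The weight η balances the two sums: Σ E x² = 1 while Σ E q² is of order η².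
  have h5 : |x| * |q| ≤ (η * x ^ 2 + q ^ 2 / η) / 2 := by
    have h6 : 0 ≤ (η * |x| - |q|) ^ 2 / η := by positivity
    have h7 : (η * |x| - |q|) ^ 2 / η = η * x ^ 2 + q ^ 2 / η - 2 * (|x| * |q|) := by
      rw [← sq_abs x, ← sq_abs q]
      field_simp
      ring
    linarith
  have h8 : |t| ^ 3 * (|x| * |q|) ≤ |t| ^ 3 * ((η * x ^ 2 + q ^ 2 / η) / 2) := by gcongr
  calc ‖U‖ * ‖_‖ ≤ 1 * (‖z‖ ^ 3 + (|t| ^ 3 * (|x| * |q|) / 2 + t ^ 4 * q ^ 2 / 8)) := by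
        refine mul_le_mul hU ?_ (norm_nonneg _) zero_le_one
        exact (norm_add_le _ _).trans
          (add_le_add (norm_exp_sub_taylor_two_le (hzn.trans hL)) h4)
    _ ≤ L * (t ^ 2 * x ^ 2 + t ^ 4 * q ^ 2 / 4)
        + (|t| ^ 3 * ((η * x ^ 2 + q ^ 2 / η) / 2) / 2 + t ^ 4 * q ^ 2 / 8) := by
        rw [one_mul]; gcongr
    _ = _ := by field_simp; ring

lemma norm_integral_phase_succ_sub_le (h : IsAlmostNormalMartingale P n F M R η) (hη : 0 < η)
    (t : ℝ) {k : ℕ} (hk : k < n) {L : ℝ} (hL : L ≤ 1)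
    (hηL : |t| * η + 3 * t ^ 2 * η ^ 2 / 2 ≤ L) :
    ‖∫ ω, phase M R t (k + 1) ω ∂P - ∫ ω, phase M R t k ω ∂P‖
      ≤ (|t| ^ 3 * η / 4 + L * t ^ 2) * ∫ ω, (M (k + 1) ω - M k ω) ^ 2 ∂P
        + (|t| ^ 3 / (4 * η) + t ^ 4 / 8 + L * t ^ 4 / 4)
          * ∫ ω, (R (k + 1) ω - R k ω) ^ 2 ∂P := by
  have hmU := h.measurable_phase t hk.le
  have hmU' := hmU.mono (h.le k hk.le) le_rfl
  have hnU := h.norm_phase_le t hk.le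
  have b1 := h.bdd_inc hk
  have b2 := h.bdd_incR hk
  have b3 : BddMeas fun ω => (M (k + 1) ω - M k ω) ^ 2 + R (k + 1) ω - R k ω :=
    (b1.sq.add (h.bdd_R hk)).sub (h.bdd_R hk.le)
  have i0 := h.integrable_phase t hk.le
  have i1 : Integrable (fun ω => phase M R t k ω * (M (k + 1) ω - M k ω : ℝ)) P :=
    (b1.integrable P).ofReal.bdd_mul hmU'.aestronglyMeasurable (Eventually.of_forall hnU)
  have i3 : Integrable (fun ω => phase M R t k ω *
      ((M (k + 1) ω - M k ω) ^ 2 + R (k + 1) ω - R k ω : ℝ)) P :=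
    (b3.integrable P).ofReal.bdd_mul hmU'.aestronglyMeasurable (Eventually.of_forall hnU)
  have z1 := integral_complex_mul_eq_zero (h.le k hk.le) P b1 (h.mart k hk) hmU hnU
  have z3 := integral_complex_mul_eq_zero (h.le k hk.le) P b3 (h.var k hk) hmU hnU
  have e : ∫ ω, phase M R t (k + 1) ω ∂P - ∫ ω, phase M R t k ω ∂P
      = ∫ ω, (phase M R t (k + 1) ω - phase M R t k ω
      - Complex.I * t * (phase M R t k ω * (M (k + 1) ω - M k ω : ℝ))
      + t ^ 2 / 2 * (phase M R t k ω *
          ((M (k + 1) ω - M k ω) ^ 2 + R (k + 1) ω - R k ω : ℝ))) ∂P := by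
    have i4 := h.integrable_phase t hk
    have j1 : Integrable (fun ω => phase M R t (k + 1) ω - phase M R t k ω) P := i4.sub i0
    have j2 : Integrable (fun ω => phase M R t (k + 1) ω - phase M R t k ω
      - Complex.I * t * (phase M R t k ω * (M (k + 1) ω - M k ω : ℝ))) P := j1.sub (i1.const_mul _)
    rw [integral_add j2 (i3.const_mul _), integral_sub j1 (i1.const_mul _), integral_sub i4 i0,
      integral_const_mul, integral_const_mul, z1, z3, mul_zero, mul_zero, sub_zero, add_zero]
  rw [e, ← integral_const_mul, ← integral_const_mul,
    ← integral_add (((BddMeas.const _).mul b1.sq).integrable P)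
      (((BddMeas.const _).mul b2.sq).integrable P)]
  refine norm_integral_le_of_norm_le ((((BddMeas.const _).mul b1.sq).add
    ((BddMeas.const _).mul b2.sq)).integrable P) (Eventually.of_forall fun ω => ?_)
  refine phase_succ_sub_remainder t k ω hη hL (le_trans ?_ hηL) (hnU ω)
  have h1 : |t| * |M (k + 1) ω - M k ω| ≤ |t| * η :=
    mul_le_mul_of_nonneg_left (h.increment k hk ω) (abs_nonneg _)
  have h2 : t ^ 2 * |R (k + 1) ω - R k ω| ≤ t ^ 2 * (3 * η ^ 2) :=
    mul_le_mul_of_nonneg_left (h.abs_incR_le hk ω) (sq_nonneg _)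
  linarith

/-- The error bound for characteristic functions. -/
noncomputable def charFunError (t η : ℝ) : ℝ :=
  |t| ^ 3 * η + 3 * t ^ 4 * η ^ 2 / 8
    + (|t| * η + 3 * t ^ 2 * η ^ 2 / 2) * (t ^ 2 + 3 * t ^ 4 * η ^ 2 / 4) + t ^ 2 * η ^ 2 / 2

lemma tendsto_charFunError (t : ℝ) : Tendsto (charFunError t) (𝓝 0) (𝓝 0) := by
  have : Continuous (charFunError t) := by unfold charFunError; fun_prop
  simpa [charFunError] using this.tendsto 0

lemma norm_charFun_sub_le (h : IsAlmostNormalMartingale P n F M R η) (hη : 0 < η) (t : ℝ)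
    (hL : |t| * η + 3 * t ^ 2 * η ^ 2 / 2 ≤ 1) :
    ‖∫ ω, Complex.exp ((t * M n ω : ℝ) * Complex.I) ∂P - Complex.exp (-(t ^ 2 / 2 : ℝ))‖
      ≤ charFunError t η := by
  have hn : ∫ ω, Complex.exp ((t * M n ω : ℝ) * Complex.I) ∂P = ∫ ω, phase M R t n ω ∂P := by
    simp [phase, h.R_last]
  have htel : ‖∫ ω, phase M R t n ω ∂P - ∫ ω, phase M R t 0 ω ∂P‖
      ≤ (|t| ^ 3 * η / 4 + (|t| * η + 3 * t ^ 2 * η ^ 2 / 2) * t ^ 2) * 1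
        + (|t| ^ 3 / (4 * η) + t ^ 4 / 8 + (|t| * η + 3 * t ^ 2 * η ^ 2 / 2) * t ^ 4 / 4)
          * (3 * η ^ 2) := by
    rw [← Finset.sum_range_sub (fun k => ∫ ω, phase M R t k ω ∂P)]
    refine (norm_sum_le _ _).trans ?_
    refine (Finset.sum_le_sum fun k hk =>
      h.norm_integral_phase_succ_sub_le hη t (Finset.mem_range.1 hk) hL le_rfl).trans ?_
    rw [Finset.sum_add_distrib, ← Finset.mul_sum, ← Finset.mul_sum, h.sum_integral_inc_sq]
    gcongr
    exact h.sum_integral_incR_sq_le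
  -- Since M_0 = 0, the initial phase is exp(-t² R_0 / 2) with |R_0 - 1| ≤ η², and x ↦ exp(-x) is
  -- 1-Lipschitz on x ≥ 0.
  have h0 : ‖∫ ω, phase M R t 0 ω ∂P - Complex.exp (-(t ^ 2 / 2 : ℝ))‖ ≤ t ^ 2 * η ^ 2 / 2 := by
    have e : ∫ ω, phase M R t 0 ω ∂P - Complex.exp (-(t ^ 2 / 2 : ℝ))
        = ∫ ω, (phase M R t 0 ω - Complex.exp (-(t ^ 2 / 2 : ℝ))) ∂P := by
      rw [integral_sub (h.integrable_phase t (Nat.zero_le n)) (integrable_const _)]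
      simp
    rw [e]
    refine (norm_integral_le_of_norm_le_const (C := t ^ 2 * η ^ 2 / 2)
      (Eventually.of_forall fun ω => ?_)).trans (by simp)
    have h1 := abs_sub_integral_le_of_osc P ((h.bdd_R (Nat.zero_le n)).integrable P)
      (h.osc 0 (Nat.zero_le n)) ω
    rw [h.integral_R] at h1
    have h2 := h.R_nonneg 0 (Nat.zero_le n) ω
    have e2 : phase M R t 0 ω - Complex.exp (-(t ^ 2 / 2 : ℝ))
        = ((Real.exp (-(t ^ 2 * R 0 ω / 2)) - Real.exp (-(t ^ 2 / 2)) : ℝ) : ℂ) := by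
      simp [phase, h.M_zero]
    rw [e2, Complex.norm_real, Real.norm_eq_abs]
    have hlip : ∀ x y : ℝ, 0 ≤ x → 0 ≤ y → Real.exp (-x) - Real.exp (-y) ≤ |x - y| := by
      intro x y hx hy
      have := Real.add_one_le_exp (x - y)
      have e3 : Real.exp (-y) = Real.exp (-x) * Real.exp (x - y) := by
        rw [← Real.exp_add]; congr 1; ring
      have h5 : Real.exp (-x) ≤ 1 := by simpa using hx
      have h6 := Real.exp_pos (-x)
      rw [e3]
      nlinarith [neg_abs_le (x - y), abs_nonneg (x - y)]
    have e4 : |t ^ 2 * R 0 ω / 2 - t ^ 2 / 2| ≤ t ^ 2 * η ^ 2 / 2 := by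
      have : t ^ 2 * R 0 ω / 2 - t ^ 2 / 2 = t ^ 2 / 2 * (R 0 ω - 1) := by ring
      rw [this, abs_mul, abs_of_nonneg (by positivity : 0 ≤ t ^ 2 / 2)]
      calc t ^ 2 / 2 * |R 0 ω - 1| ≤ t ^ 2 / 2 * η ^ 2 := by gcongr
        _ = _ := by ring
    refine le_trans ?_ e4
    rw [abs_sub_le_iff]
    refine ⟨hlip _ _ (by positivity) (by positivity), ?_⟩
    rw [abs_sub_comm]
    exact hlip _ _ (by positivity) (by positivity)
  rw [hn]
  calc _ ≤ _ := norm_sub_le_norm_sub_add_norm_sub _ (∫ ω, phase M R t 0 ω ∂P) _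
    _ ≤ _ := add_le_add htel h0
    _ = charFunError t η := by
      unfold charFunError
      field_simp
      ring

lemma mono (h : IsAlmostNormalMartingale P n F M R η) (hη : 0 ≤ η) {η' : ℝ} (hη' : η ≤ η') :
    IsAlmostNormalMartingale P n F M R η' :=
  { h with
    increment := fun k hk ω => (h.increment k hk ω).trans hη'
    osc := fun k hk ω ω' => (h.osc k hk ω ω').trans (pow_le_pow_left₀ hη hη' 2) }

/-- Increments are orthogonal to the past. At k = n this identifies the normalizing constant with
the variance of the sum. -/
lemma integral_M_sq_add (h : IsAlmostNormalMartingale P n F M R η) {k : ℕ} (hk : k ≤ n) :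
    ∫ ω, (M k ω ^ 2 + R k ω) ∂P = 1 := by
  induction k with
  | zero => simpa [h.M_zero] using h.integral_R
  | succ k ih =>
    have ih := ih (Nat.le_of_succ_le hk)
    have h1 := h.mart k hk _ (h.bddMeas_M k (Nat.le_of_succ_le hk))
    have h2 := h.var k hk (fun _ => 1) (@BddMeas.const _ (F k) 1)
    have b0 := h.bdd_M (Nat.le_of_succ_le hk)
    have b1 := h.bdd_inc hk
    have r0 := h.bdd_R (Nat.le_of_succ_le hk)
    have r1 := h.bdd_R hk
    have e : ∀ ω, M (k + 1) ω ^ 2 + R (k + 1) ω = (M k ω ^ 2 + R k ω)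
        + (2 * (M k ω * (M (k + 1) ω - M k ω))
          + 1 * ((M (k + 1) ω - M k ω) ^ 2 + R (k + 1) ω - R k ω)) := fun ω => by ring
    simp_rw [e]
    rw [integral_add ((b0.sq.add r0).integrable P)
      ((((BddMeas.const 2).mul (b0.mul b1)).add
        ((BddMeas.const 1).mul ((b1.sq.add r1).sub r0))).integrable P),
      integral_add (((BddMeas.const 2).mul (b0.mul b1)).integrable P)
        (((BddMeas.const 1).mul ((b1.sq.add r1).sub r0)).integrable P),
      integral_const_mul, h1, h2, ih]
    simp

end IsAlmostNormalMartingale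

/-! ### The Markov–Dobrushin coefficient and oscillations. -/

/-- The conditional mean `x ↦ ∫ g dκ(x)`. -/
noncomputable def kerMean {S : Type*} [MeasurableSpace S] (κ : Kernel S S) (g : S → ℝ) (x : S) : ℝ :=
  ∫ y, g y ∂(κ x)

section Contraction

variable {S : Type*} [MeasurableSpace S]

lemma BddMeas.kerMean {g : S → ℝ} (hg : BddMeas g) (κ : Kernel S S) [IsMarkovKernel κ] :
    BddMeas (kerMean κ g) := by
  obtain ⟨hm, C, hC⟩ := hg
  refine ⟨(hm.stronglyMeasurable.integral_kernel (κ := κ)).measurable, C, fun x => ?_⟩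
  have := norm_integral_le_of_norm_le_const (μ := κ x) (f := g) (C := C)
    (Eventually.of_forall hC)
  rw [probReal_univ, mul_one] at this
  exact this

lemma exists_interval_of_osc [Nonempty S] {h : S → ℝ} (hh : BddMeas h) {L : ℝ}
    (hL : ∀ x y, |h x - h y| ≤ L) : ∃ p, ∀ x, p ≤ h x ∧ h x ≤ p + L := by
  obtain ⟨-, C, hC⟩ := hh
  have hb : BddBelow (Set.range h) := ⟨-C, by rintro _ ⟨x, rfl⟩; exact (abs_le.1 (hC x)).1⟩
  refine ⟨⨅ x, h x, fun x => ⟨ciInf_le hb x, ?_⟩⟩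
  have : h x - L ≤ ⨅ y, h y := le_ciInf fun y => by linarith [(abs_le.1 (hL x y)).2]
  linarith

/-- Layer-cake formula: h minus its lower bound takes values in [0, L], so its integral is that of
the probabilities of superlevel sets over (0, L], and these differ by at most δ. -/
lemma abs_integral_sub_le_of_osc (μ ν : Measure S) [IsProbabilityMeasure μ]
    [IsProbabilityMeasure ν] {δ : ℝ} (hδ : ∀ A, MeasurableSet A → |μ.real A - ν.real A| ≤ δ)
    {h : S → ℝ} (hh : BddMeas h) {L : ℝ} (hL : ∀ x y, |h x - h y| ≤ L) :
    |∫ y, h y ∂μ - ∫ y, h y ∂ν| ≤ δ * L := by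
  have : Nonempty S := by
    by_contra hS
    rw [not_nonempty_iff] at hS
    exact IsProbabilityMeasure.ne_zero μ (Measure.eq_zero_of_isEmpty μ)
  obtain ⟨p, hp⟩ := exists_interval_of_osc hh hL
  obtain ⟨x₀⟩ := this
  have hL0 : 0 ≤ L := (abs_nonneg _).trans (hL x₀ x₀)
  have hg : BddMeas fun y => h y - p := hh.sub (BddMeas.const p)
  have key : ∀ (ρ : Measure S) [IsProbabilityMeasure ρ],
      ∫ y, h y ∂ρ = p + ∫ t in Set.Ioc 0 L, ρ.real {a | t ≤ h a - p} := by
    intro ρ _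
    rw [← (hg.integrable ρ).integral_eq_integral_Ioc_meas_le
      (Eventually.of_forall fun y => by simpa using (hp y).1)
      (Eventually.of_forall fun y => by simpa [add_comm] using (hp y).2),
      integral_sub (hh.integrable ρ) (integrable_const _)]
    simp
  have hint : ∀ (ρ : Measure S) [IsProbabilityMeasure ρ],
      IntegrableOn (fun t => ρ.real {a | t ≤ h a - p}) (Set.Ioc 0 L) := by
    intro ρ _
    have hanti : Antitone fun t => ρ.real {a | t ≤ h a - p} := fun s t hst =>
      measureReal_mono fun a (ha : t ≤ h a - p) => hst.trans ha
    refine Measure.integrableOn_of_bounded (M := 1) (by simp)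
      hanti.measurable.aestronglyMeasurable (Eventually.of_forall fun t => ?_)
    rw [Real.norm_of_nonneg measureReal_nonneg]
    exact measureReal_le_one
  rw [key μ, key ν, add_sub_add_left_eq_sub, ← integral_sub (hint μ) (hint ν)]
  have := norm_setIntegral_le_of_norm_le_const (μ := volume) (s := Set.Ioc 0 L) (C := δ)
    (f := fun t => μ.real {a | t ≤ h a - p} - ν.real {a | t ≤ h a - p}) (by simp)
    (fun t _ => hδ _ (measurableSet_le measurable_const hg.1))
  simpa [Measure.real, ENNReal.toReal_ofReal hL0] using this

lemma abs_sub_le_mdDelta (κ : Kernel S S) [IsMarkovKernel κ] (x y : S) {A : Set S}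
    (hA : MeasurableSet A) : |(κ x).real A - (κ y).real A| ≤ mdDelta κ := by
  refine le_ciSup (f := fun q : S × S × {A : Set S // MeasurableSet A} =>
    |(κ q.1).real q.2.2 - (κ q.2.1).real q.2.2|) ⟨1, ?_⟩ (x, y, ⟨A, hA⟩)
  rintro _ ⟨q, rfl⟩
  have h1 : (κ q.1).real q.2.2 ≤ 1 := measureReal_le_one
  have h2 : (κ q.2.1).real q.2.2 ≤ 1 := measureReal_le_one
  have h3 : 0 ≤ (κ q.1).real q.2.2 := measureReal_nonneg
  have h4 : 0 ≤ (κ q.2.1).real q.2.2 := measureReal_nonneg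
  exact abs_sub_le_iff.2 ⟨by linarith, by linarith⟩

lemma mdDelta_nonneg (κ : Kernel S S) : 0 ≤ mdDelta κ := Real.iSup_nonneg fun _ => abs_nonneg _

lemma mdDelta_le (κ : Kernel S S) {d : ℝ} (hd : 0 ≤ d)
    (h : ∀ x y A, MeasurableSet A → |(κ x).real A - (κ y).real A| ≤ d) : mdDelta κ ≤ d :=
  Real.iSup_le (fun q => h _ _ _ q.2.2.2) hd

lemma mdDelta_le_one (κ : Kernel S S) [IsMarkovKernel κ] : mdDelta κ ≤ 1 := by
  refine mdDelta_le κ zero_le_one fun x y A _ => ?_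
  have h1 : (κ x).real A ≤ 1 := measureReal_le_one
  have h2 : (κ y).real A ≤ 1 := measureReal_le_one
  have h3 : 0 ≤ (κ x).real A := measureReal_nonneg
  have h4 : 0 ≤ (κ y).real A := measureReal_nonneg
  exact abs_sub_le_iff.2 ⟨by linarith, by linarith⟩

/-- The Markov–Dobrushin coefficient contracts oscillations. -/
lemma osc_kerMean_le (κ : Kernel S S) [IsMarkovKernel κ] {h : S → ℝ} (hh : BddMeas h) {L : ℝ}
    (hL : ∀ x y, |h x - h y| ≤ L) (x y : S) :
    |kerMean κ h x - kerMean κ h y| ≤ mdDelta κ * L :=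
  abs_integral_sub_le_of_osc (κ x) (κ y) (fun _ hA => abs_sub_le_mdDelta κ x y hA) hh hL

end Contraction

/-! ### Contraction of variances by the coefficient δ. -/

section VarianceContraction

/-- For a log-convex sequence the ratio of consecutive terms is nondecreasing, so the first ratio is
at most the asymptotic rate of decay δ. The constant `K` is irrelevant in the limit. -/
lemma le_of_logConvex {b : ℕ → ℝ} {δ K : ℝ} (hb : ∀ j, 0 ≤ b j)
    (hc : ∀ j, b (j + 1) ^ 2 ≤ b j * b (j + 2)) (hδ : 0 ≤ δ)
    (hK : ∀ j, b (2 * j) ≤ K * (δ ^ j) ^ 2) : b 1 ≤ δ * b 0 := by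
  by_contra! hlt
  have h0 : 0 < b 0 := by
    rcases (hb 0).eq_or_lt with h | h
    · have := hc 0
      rw [← h] at this hlt
      nlinarith
    · exact h
  set r := b 1 / b 0 with hr
  have hrδ : δ < r := by rwa [hr, lt_div_iff₀ h0]
  have hr0 : 0 < r := hδ.trans_lt hrδ
  have hstep : ∀ j, 0 < b j ∧ r * b j ≤ b (j + 1) := by
    intro j
    induction j with
    | zero => exact ⟨h0, by rw [hr, div_mul_cancel₀ _ h0.ne']⟩
    | succ j ih =>
      obtain ⟨hj, hle⟩ := ih
      have hpos : 0 < b (j + 1) := (mul_pos hr0 hj).trans_le hle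
      refine ⟨hpos, ?_⟩
      have h1 : b j * (r * b (j + 1)) ≤ b j * b (j + 2) := by
        nlinarith [hc j, mul_le_mul_of_nonneg_right hle hpos.le]
      exact le_of_mul_le_mul_left h1 hj
  have hpow : ∀ j, r ^ j * b 0 ≤ b j := by
    intro j
    induction j with
    | zero => simp
    | succ j ih =>
      calc r ^ (j + 1) * b 0 = r * (r ^ j * b 0) := by ring
        _ ≤ r * b j := by gcongr
        _ ≤ _ := (hstep j).2
  have hle : ∀ j : ℕ, b 0 ≤ K * ((δ / r) ^ 2) ^ j := by
    intro j
    have h1 := (hpow (2 * j)).trans (hK j)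
    have h2 : ((δ / r) ^ 2) ^ j = (δ ^ j) ^ 2 / r ^ (2 * j) := by
      rw [← pow_mul, div_pow, ← pow_mul, mul_comm j 2]
    rw [h2, ← mul_div_assoc, le_div_iff₀ (by positivity)]
    linarith
  have hq : (δ / r) ^ 2 < 1 := by
    have : δ / r < 1 := (div_lt_one hr0).2 hrδ
    have h' : 0 ≤ δ / r := by positivity
    nlinarith
  have hlim : Tendsto (fun j : ℕ => K * ((δ / r) ^ 2) ^ j) atTop (𝓝 (K * 0)) :=
    (tendsto_pow_atTop_nhds_zero_of_lt_one (by positivity) hq).const_mul K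
  have := ge_of_tendsto' hlim hle
  linarith

variable {Ω : Type*} {m1 m2 m0 : MeasurableSpace Ω}

/-- Alternating conditional expectations of `u` on `m1` and `m2`, starting with `m1`. -/
noncomputable def altCondExp {m0 : MeasurableSpace Ω} (P : Measure Ω) (m1 m2 : MeasurableSpace Ω)
    (u : Ω → ℝ) : ℕ → Ω → ℝ
  | 0 => u
  | j + 1 => P[altCondExp P m1 m2 u j | if Even j then m1 else m2]

lemma integrable_of_ae_bdd {P : Measure Ω} [IsFiniteMeasure P] {v : Ω → ℝ} {C : ℝ}
    (hv : AEStronglyMeasurable v P) (hC : ∀ᵐ ω ∂P, |v ω| ≤ C) : Integrable v P :=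
  Integrable.of_bound hv C hC

lemma integral_mul_condExp {Ω : Type*} {m m0 : MeasurableSpace Ω} (hm : m ≤ m0) (P : Measure Ω)
    [IsFiniteMeasure P] {v w : Ω → ℝ} {C : ℝ} (hv : StronglyMeasurable[m] v)
    (hvC : ∀ᵐ ω ∂P, |v ω| ≤ C) (hw : Integrable w P) :
    ∫ ω, v ω * (P[w | m]) ω ∂P = ∫ ω, v ω * w ω ∂P := by
  have hi : Integrable (v * w) P :=
    hw.bdd_mul (hv.mono hm).aestronglyMeasurable hvC
  have := condExp_mul_of_stronglyMeasurable_left (μ := P) hv hi hw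
  rw [← integral_condExp hm (f := fun ω => v ω * w ω)]
  exact (integral_congr_ae this).symm

variable {P : Measure Ω} [IsProbabilityMeasure P] {u : Ω → ℝ}

lemma altCondExp_stronglyMeasurable (hu : StronglyMeasurable[m2] u) (j : ℕ) :
    StronglyMeasurable[if Even (j + 1) then m1 else m2] (altCondExp P m1 m2 u j) := by
  cases j with
  | zero =>
    rw [if_neg (by simp)]
    exact hu
  | succ j =>
    have : (if Even (j + 1 + 1) then m1 else m2) = (if Even j then m1 else m2) := by
      simp [Nat.even_add_one]
    rw [this]
    exact stronglyMeasurable_condExp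

lemma altCondExp_ae_bdd {C : ℝ} (huC : ∀ ω, |u ω| ≤ C) (j : ℕ) :
    ∀ᵐ ω ∂P, |altCondExp P m1 m2 u j ω| ≤ C := by
  induction j with
  | zero => exact Eventually.of_forall huC
  | succ j ih => exact ae_bdd_abs_condExp_of_ae_bdd_abs ih

/-- Conditional expectations are self-adjoint projections, so ‖u_{j+1}‖² equals ⟨u_j, u_{j+2}⟩, and
Cauchy–Schwarz applies. The latter is obtained from the discriminant of s ↦ ‖u_j - s u_{j+2}‖². -/
lemma integral_altCondExp_logConvex (h1 : m1 ≤ m0) (h2 : m2 ≤ m0)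
    (hu : StronglyMeasurable[m2] u) {C : ℝ} (huC : ∀ ω, |u ω| ≤ C) (j : ℕ) :
    (∫ ω, altCondExp P m1 m2 u (j + 1) ω ^ 2 ∂P) ^ 2
      ≤ (∫ ω, altCondExp P m1 m2 u j ω ^ 2 ∂P) * ∫ ω, altCondExp P m1 m2 u (j + 2) ω ^ 2 ∂P := by
  have hle : ∀ j, (if Even j then m1 else m2) ≤ m0 := fun j : ℕ => by split_ifs <;> assumption
  have hm := altCondExp_stronglyMeasurable (P := P) (m1 := m1) hu
  have hae : ∀ j, AEStronglyMeasurable (altCondExp P m1 m2 u j) P := fun j =>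
    ((hm j).mono (hle (j + 1))).aestronglyMeasurable
  have hb := altCondExp_ae_bdd (P := P) (m1 := m1) (m2 := m2) huC
  have hi : ∀ j, Integrable (altCondExp P m1 m2 u j) P := fun j =>
    integrable_of_ae_bdd (hae j) (hb j)
  have hmul : ∀ i k, Integrable (fun ω => altCondExp P m1 m2 u i ω * altCondExp P m1 m2 u k ω) P :=
    fun i k => (hi k).bdd_mul (hae i) (hb i)
  have e1 : ∫ ω, altCondExp P m1 m2 u j ω * altCondExp P m1 m2 u (j + 1) ω ∂P
      = ∫ ω, altCondExp P m1 m2 u (j + 1) ω ^ 2 ∂P := by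
    have hm' : StronglyMeasurable[if Even j then m1 else m2] (altCondExp P m1 m2 u (j + 1)) :=
      stronglyMeasurable_condExp
    have := integral_mul_condExp (hle j) P hm' (hb (j + 1)) (hi j)
    simp_rw [pow_two]
    rw [show ∫ ω, altCondExp P m1 m2 u (j + 1) ω * altCondExp P m1 m2 u (j + 1) ω ∂P = _ from this]
    simp_rw [mul_comm]
  have e2 : ∫ ω, altCondExp P m1 m2 u j ω * altCondExp P m1 m2 u (j + 2) ω ∂P
      = ∫ ω, altCondExp P m1 m2 u (j + 1) ω ^ 2 ∂P := by
    rw [← e1]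
    exact integral_mul_condExp (hle (j + 1)) P (hm j) (hb j) (hi (j + 1))
  have hq : ∀ s : ℝ, 0 ≤ (∫ ω, altCondExp P m1 m2 u (j + 2) ω ^ 2 ∂P) * (s * s)
      + (-2 * ∫ ω, altCondExp P m1 m2 u (j + 1) ω ^ 2 ∂P) * s
      + ∫ ω, altCondExp P m1 m2 u j ω ^ 2 ∂P := by
    intro s
    have h0 : 0 ≤ ∫ ω, (altCondExp P m1 m2 u j ω - s * altCondExp P m1 m2 u (j + 2) ω) ^ 2 ∂P :=
      integral_nonneg fun _ => sq_nonneg _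
    have ex : ∀ ω, (altCondExp P m1 m2 u j ω - s * altCondExp P m1 m2 u (j + 2) ω) ^ 2
        = altCondExp P m1 m2 u j ω * altCondExp P m1 m2 u j ω
          + (-2 * s) * (altCondExp P m1 m2 u j ω * altCondExp P m1 m2 u (j + 2) ω)
          + (s * s) * (altCondExp P m1 m2 u (j + 2) ω * altCondExp P m1 m2 u (j + 2) ω) :=
      fun ω => by ring
    simp_rw [ex] at h0
    have k1 := (hmul j (j + 2)).const_mul (-2 * s)
    have k2 := (hmul (j + 2) (j + 2)).const_mul (s * s)
    have k3 : Integrable (fun ω => altCondExp P m1 m2 u j ω * altCondExp P m1 m2 u j ω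
        + (-2 * s) * (altCondExp P m1 m2 u j ω * altCondExp P m1 m2 u (j + 2) ω)) P :=
      (hmul j j).add k1
    rw [integral_add k3 k2, integral_add (hmul j j) k1, integral_const_mul,
      integral_const_mul, e2] at h0
    simp_rw [pow_two] at h0 ⊢
    linarith
  have := discrim_le_zero hq
  unfold discrim at this
  nlinarith

variable {S : Type*} [MeasurableSpace S]

/-- A Markov transition with coefficient `δ` contracts variances by the factor `δ`. -/
lemma integral_kerMean_sq_le {X Y : Ω → S} (hX : Measurable X) (hY : Measurable Y)
    (κ : Kernel S S) [IsMarkovKernel κ]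
    (hκ : ∀ g : S → ℝ, BddMeas g → P[fun ω => g (Y ω) | MeasurableSpace.comap X inferInstance]
      =ᵐ[P] fun ω => kerMean κ g (X ω))
    {g : S → ℝ} (hg : BddMeas g) (hg0 : ∫ ω, g (Y ω) ∂P = 0) :
    ∫ ω, kerMean κ g (X ω) ^ 2 ∂P ≤ mdDelta κ * ∫ ω, g (Y ω) ^ 2 ∂P := by
  obtain ⟨ω₀⟩ := nonempty_of_isProbabilityMeasure P
  have : Nonempty S := ⟨X ω₀⟩
  set m1 : MeasurableSpace Ω := MeasurableSpace.comap X inferInstance with hm1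
  set m2 : MeasurableSpace Ω := MeasurableSpace.comap Y inferInstance with hm2
  have h1 : m1 ≤ m0 := hX.comap_le
  have h2 : m2 ≤ m0 := hY.comap_le
  have hu : StronglyMeasurable[m2] fun ω => g (Y ω) :=
    (hg.1.comp (comap_measurable Y)).stronglyMeasurable
  obtain ⟨C, hC⟩ := hg.2
  have huC : ∀ ω, |g (Y ω)| ≤ C := fun ω => hC _
  have hC0 : 0 ≤ C := (abs_nonneg _).trans (huC ω₀)
  set u := altCondExp P m1 m2 (fun ω => g (Y ω)) with hudef
  have hle : ∀ j, (if Even j then m1 else m2) ≤ m0 := fun j : ℕ => by split_ifs <;> assumption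
  have hm := altCondExp_stronglyMeasurable (P := P) (m1 := m1) hu
  have hae : ∀ j, AEStronglyMeasurable[m0] (u j) P := fun j =>
    ((hm j).mono (hle (j + 1))).aestronglyMeasurable
  have hi : ∀ j, Integrable (u j) P := fun j =>
    integrable_of_ae_bdd (hae j) (altCondExp_ae_bdd huC j)
  have hmean : ∀ j, ∫ ω, u j ω ∂P = 0 := by
    intro j
    induction j with
    | zero => exact hg0
    | succ j ih => rw [← ih]; exact integral_condExp (hle j)
  -- Going back and forth between Y and X costs one transition by κ, which shrinks the oscillation
  -- by δ; conditioning on Y does not enlarge it. This crude decay, fed into log-convexity, gives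
  -- the sharp first ratio.
  have hosc : ∀ j, ∃ p, ∀ᵐ ω ∂P, p ≤ u (2 * j) ω ∧ u (2 * j) ω ≤ p + mdDelta κ ^ j * (2 * C) := by
    intro j
    induction j with
    | zero =>
      refine ⟨-C, Eventually.of_forall fun ω => ?_⟩
      have := abs_le.1 (huC ω)
      constructor
      · exact this.1
      · have := this.2
        simp only [pow_zero, one_mul, mul_zero]
        change g (Y ω) ≤ _
        linarith
    | succ j ih =>
      obtain ⟨p, hp⟩ := ih
      set L := mdDelta κ ^ j * (2 * C) with hL
      have hL0 : 0 ≤ L := by have := mdDelta_nonneg κ; positivity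
      have hms : StronglyMeasurable[m2] (u (2 * j)) := by
        have := hm (2 * j)
        rwa [if_neg (by simp)] at this
      obtain ⟨k, hk, hke⟩ := hms.exists_eq_measurable_comp
      -- The bounds on `k (Y ω)` hold only almost surely, whereas the contraction of oscillations
      -- needs them at every point; truncation changes nothing almost surely.
      set k' : S → ℝ := fun y => max p (min (k y) (p + L)) with hk'
      have hk'1 : ∀ y, p ≤ k' y ∧ k' y ≤ p + L := fun y =>
        ⟨le_max_left _ _, max_le (by linarith) (min_le_right _ _)⟩
      have hk'b : BddMeas k' := by
        refine ⟨measurable_const.max (hk.measurable.min measurable_const), |p| + L, fun y => ?_⟩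
        have := hk'1 y
        rw [abs_le]
        constructor <;> linarith [neg_abs_le p, le_abs_self p]
      have hk'o : ∀ y y', |k' y - k' y'| ≤ L := fun y y' => by
        have a := hk'1 y
        have b := hk'1 y'
        rw [abs_le]; constructor <;> linarith
      have hek : u (2 * j) =ᵐ[P] fun ω => k' (Y ω) := by
        filter_upwards [hp] with ω hω
        have : u (2 * j) ω = k (Y ω) := congrFun hke ω
        rw [this] at hω
        rw [this, hk']
        simp [hω.1, hω.2]
      obtain ⟨p', hp'⟩ := exists_interval_of_osc (hk'b.kerMean κ) (osc_kerMean_le κ hk'b hk'o)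
      have hodd : ∀ᵐ ω ∂P, p' ≤ u (2 * j + 1) ω ∧ u (2 * j + 1) ω ≤ p' + mdDelta κ * L := by
        have e : u (2 * j + 1) = P[u (2 * j) | m1] := by
          rw [hudef, altCondExp, if_pos (by simp)]
        rw [e]
        filter_upwards [condExp_congr_ae (m := m1) hek, hκ k' hk'b] with ω a b
        rw [a, b]
        exact hp' _
      refine ⟨p', ?_⟩
      have e : u (2 * (j + 1)) = P[u (2 * j + 1) | m2] := by
        rw [show 2 * (j + 1) = (2 * j + 1) + 1 by ring, hudef, altCondExp, if_neg (by simp)]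
      have a1 := condExp_mono (m := m2) (integrable_const p') (hi (2 * j + 1))
        (hodd.mono fun ω h => h.1)
      have a2 := condExp_mono (m := m2) (hi (2 * j + 1)) (integrable_const (p' + mdDelta κ * L))
        (hodd.mono fun ω h => h.2)
      rw [condExp_const h2] at a1 a2
      rw [e]
      filter_upwards [a1, a2] with ω b1 b2
      refine ⟨b1, b2.trans (le_of_eq ?_)⟩
      rw [hL]; ring
  have hfin := le_of_logConvex (b := fun j => ∫ ω, u j ω ^ 2 ∂P) (δ := mdDelta κ)
    (K := (2 * C) ^ 2) (fun j => integral_nonneg fun _ => sq_nonneg _)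
    (integral_altCondExp_logConvex h1 h2 hu huC) (mdDelta_nonneg κ) (by
      intro j
      obtain ⟨p, hp⟩ := hosc j
      -- The mean is 0, so the interval contains 0 and its length bounds |u|.
      have hp1 : p ≤ 0 := by
        have := integral_mono_ae (integrable_const p) (hi (2 * j)) (hp.mono fun ω h => h.1)
        rw [hmean] at this
        simpa using this
      have hp2 : 0 ≤ p + mdDelta κ ^ j * (2 * C) := by
        have := integral_mono_ae (hi (2 * j)) (integrable_const (p + mdDelta κ ^ j * (2 * C)))
          (hp.mono fun ω h => h.2)
        rw [hmean] at this
        simpa using this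
      have hb : ∀ᵐ ω ∂P, u (2 * j) ω ^ 2 ≤ (2 * C) ^ 2 * (mdDelta κ ^ j) ^ 2 := by
        filter_upwards [hp] with ω h
        rw [← mul_pow, mul_comm (2 * C)]
        exact sq_le_sq' (by linarith) (by linarith)
      have hi2 : Integrable (fun ω => u (2 * j) ω ^ 2) P := by
        refine integrable_of_ae_bdd (C := (2 * C) ^ 2 * (mdDelta κ ^ j) ^ 2)
          ((hae _).pow 2) (hb.mono fun ω h => ?_)
        rw [abs_of_nonneg (sq_nonneg _)]
        exact h
      have := integral_mono_ae hi2 (integrable_const _) hb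
      simpa using this)
  have e1 : ∫ ω, u 1 ω ^ 2 ∂P = ∫ ω, kerMean κ g (X ω) ^ 2 ∂P := by
    refine integral_congr_ae ?_
    have e : u 1 = P[fun ω => g (Y ω) | m1] := by
      rw [hudef, altCondExp, if_pos (by simp)]
      rfl
    rw [e]
    filter_upwards [hκ g hg] with ω h
    rw [h]
  rw [← e1]
  exact hfin

end VarianceContraction

/-! ### Conditional expectations of future sums. -/

section Tail

variable {S : Type*} [MeasurableSpace S]

lemma kerMean_add (κ : Kernel S S) [IsMarkovKernel κ] {g h : S → ℝ} (hg : BddMeas g)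
    (hh : BddMeas h) (x : S) :
    kerMean κ (fun y => g y + h y) x = kerMean κ g x + kerMean κ h x :=
  integral_add (hg.integrable _) (hh.integrable _)

lemma kerMean_kerMean (κ η : Kernel S S) [IsMarkovKernel κ] [IsMarkovKernel η] {g : S → ℝ}
    (hg : BddMeas g) (x : S) : kerMean κ (kerMean η g) x = kerMean (η ∘ₖ κ) g x :=
  (Kernel.integral_comp (hg.integrable _)).symm

/-- `E (f (k + 1) (X (k + 1)) + ⋯ + f (k + m) (X (k + m)) | X k = x)`. -/
noncomputable def tailSumAux (κ : ℕ → Kernel S S) (f : ℕ → S → ℝ) : ℕ → ℕ → S → ℝ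
  | 0, _ => fun _ => 0
  | m + 1, k => kerMean (κ k) fun y => f (k + 1) y + tailSumAux κ f m (k + 1) y

/-- `E (f (k + 1) (X (k + 1)) + ⋯ + f n (X n) | X k = x)`. -/
noncomputable def tailSum (κ : ℕ → Kernel S S) (f : ℕ → S → ℝ) (n k : ℕ) : S → ℝ :=
  tailSumAux κ f (n - k) k

variable {κ : ℕ → Kernel S S} {f : ℕ → S → ℝ} {n : ℕ}

lemma tailSum_self (x : S) : tailSum κ f n n x = 0 := by simp [tailSum, tailSumAux]

lemma tailSum_of_lt {k : ℕ} (hk : k < n) :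
    tailSum κ f n k = kerMean (κ k) fun y => f (k + 1) y + tailSum κ f n (k + 1) y := by
  rw [tailSum, tailSum, show n - k = (n - (k + 1)) + 1 by omega, tailSumAux]

/-- Backward induction from `n` down to `0`. -/
lemma backward_induction {p : ℕ → Prop} (n : ℕ) (hn : p n) (h : ∀ k < n, p (k + 1) → p k) :
    ∀ k ≤ n, p k := by
  intro k hk
  induction hk using Nat.decreasingInduction with
  | self => exact hn
  | of_succ k hk ih => exact h k hk ih

variable [∀ k, IsMarkovKernel (κ k)]

lemma bddMeas_tailSum (hf : ∀ i ∈ Finset.Icc 1 n, BddMeas (f i)) :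
    ∀ k ≤ n, BddMeas (tailSum κ f n k) := by
  refine backward_induction n ?_ fun k hk ih => ?_
  · have : tailSum κ f n n = fun _ => 0 := funext fun x => tailSum_self x
    rw [this]
    exact BddMeas.const 0
  · rw [tailSum_of_lt hk]
    exact ((hf (k + 1) (by simp; omega)).add ih).kerMean _

lemma osc_add {g h : S → ℝ} {L B : ℝ} (hg : ∀ x y, |g x - g y| ≤ L)
    (hh : ∀ x y, |h x - h y| ≤ B) (x y : S) : |(g x + h x) - (g y + h y)| ≤ L + B := by
  rw [add_sub_add_comm]
  exact (abs_add_le _ _).trans (add_le_add (hg x y) (hh x y))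

/-- If the two-step kernels have coefficients at most `1 - α`, then conditional expectations of
future sums of functions of oscillation at most `L` oscillate by at most `2 L / α`. -/
lemma osc_tailSum_le (hf : ∀ i ∈ Finset.Icc 1 n, BddMeas (f i)) {L α : ℝ} (hL0 : 0 ≤ L)
    (hL : ∀ i ∈ Finset.Icc 1 n, ∀ x y, |f i x - f i y| ≤ L) (hα : 0 < α) (hα1 : α ≤ 1)
    (hδ : ∀ k, k + 1 < n → mdDelta (κ (k + 1) ∘ₖ κ k) ≤ 1 - α) :
    ∀ k ≤ n, ∀ x y, |tailSum κ f n k x - tailSum κ f n k y| ≤ 2 * L / α := by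
  have hLα : L ≤ L / α := by rw [le_div_iff₀ hα]; nlinarith
  have hB : 0 ≤ 2 * L / α := by positivity
  have h2 : 2 * L / α = 2 * (L / α) := by ring
  have hone : ∀ k < n, ∀ x y, |kerMean (κ k) (f (k + 1)) x - kerMean (κ k) (f (k + 1)) y| ≤ L := by
    intro k hk x y
    have hm : k + 1 ∈ Finset.Icc 1 n := by simp; omega
    refine (osc_kerMean_le (κ k) (hf _ hm) (hL _ hm) x y).trans ?_
    nlinarith [mdDelta_le_one (κ k)]
  -- The recursion reaches from k to k + 2, so the bound is carried for two consecutive indices.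
  suffices ∀ k ≤ n, (∀ x y, |tailSum κ f n k x - tailSum κ f n k y| ≤ 2 * L / α) ∧
      (k + 1 ≤ n → ∀ x y, |tailSum κ f n (k + 1) x - tailSum κ f n (k + 1) y| ≤ 2 * L / α) from
    fun k hk => (this k hk).1
  refine backward_induction n ⟨fun x y => by simpa [tailSum_self] using hB, by omega⟩ ?_
  intro k hk ih
  refine ⟨fun x y => ?_, fun _ => ih.1⟩
  have hm : k + 1 ∈ Finset.Icc 1 n := by simp; omega
  have ht := bddMeas_tailSum (κ := κ) hf
  have e : ∀ x, tailSum κ f n k x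
      = kerMean (κ k) (f (k + 1)) x + kerMean (κ k) (tailSum κ f n (k + 1)) x := fun x => by
    rw [tailSum_of_lt hk, kerMean_add (κ k) (hf _ hm) (ht _ hk)]
  rcases Nat.lt_or_ge (k + 1) n with hk2 | hk2
  · have hm2 : k + 2 ∈ Finset.Icc 1 n := by simp; omega
    have hb := (hf _ hm2).add (ht _ hk2)
    have e2 : ∀ x, kerMean (κ k) (tailSum κ f n (k + 1)) x
        = kerMean (κ (k + 1) ∘ₖ κ k) (fun y => f (k + 2) y + tailSum κ f n (k + 2) y) x := fun x => by
      rw [tailSum_of_lt hk2, kerMean_kerMean _ _ hb]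
    have htwo : ∀ x y, |kerMean (κ k) (tailSum κ f n (k + 1)) x
        - kerMean (κ k) (tailSum κ f n (k + 1)) y| ≤ (1 - α) * (L + 2 * L / α) := by
      intro x y
      rw [e2, e2]
      refine (osc_kerMean_le _ hb (osc_add (hL _ hm2) (ih.2 hk2)) x y).trans ?_
      exact mul_le_mul_of_nonneg_right (hδ k hk2) (by positivity)
    rw [e, e]
    refine (osc_add (hone k hk) htwo x y).trans ?_
    -- The bound B = 2 L / α satisfies L + (1 - α)(L + B) ≤ B, with slack α L.
    have : (1 - α) * (L + 2 * L / α) = L - α * L + 2 * L / α - 2 * L := by field_simp; ring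
    rw [this]
    nlinarith
  · have hkn : k + 1 = n := by omega
    have e2 : ∀ x, kerMean (κ k) (tailSum κ f n (k + 1)) x = 0 := fun x => by
      rw [hkn, kerMean]
      simp [tailSum_self]
    rw [e, e, e2, e2, add_zero, add_zero]
    refine (hone k hk x y).trans ?_
    rw [h2]
    linarith [hL0.trans hLα]

end Tail

/-! ### The martingale and the conditional variances of a centered chain. -/

/-- A chain `X 0, …, X n` with Markov kernels `κ 0, …, κ (n - 1)` with respect to a family `F` of
`σ`-algebras, whose first kernel is constant, with centered functions `f 1, …, f n` of oscillation
at most `L`, whose two-step kernels have coefficients at most `1 - α`. -/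
structure IsCenteredChain {Ω S : Type*} [m0 : MeasurableSpace Ω] [MeasurableSpace S]
    (P : Measure Ω) (n : ℕ) (F : ℕ → MeasurableSpace Ω) (κ : ℕ → Kernel S S) (X : ℕ → Ω → S)
    (f : ℕ → S → ℝ) (L α : ℝ) : Prop where
  le : ∀ k ≤ n, F k ≤ m0
  adapted : ∀ i k, i ≤ k → k ≤ n → Measurable[F k] (X i)
  condExp : ∀ k < n, ∀ g : S → ℝ, BddMeas g →
    P[fun ω => g (X (k + 1) ω) | F k] =ᵐ[P] fun ω => kerMean (κ k) g (X k ω)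
  start : ∀ x y, κ 0 x = κ 0 y
  bddMeas : ∀ i ∈ Finset.Icc 1 n, BddMeas (f i)
  osc : ∀ i ∈ Finset.Icc 1 n, ∀ x y, |f i x - f i y| ≤ L
  centered : ∀ i ∈ Finset.Icc 1 n, ∫ ω, f i (X i ω) ∂P = 0
  nonneg : 0 ≤ L
  pos : 0 < α
  le_one : α ≤ 1
  delta : ∀ k, k + 1 < n → mdDelta (κ (k + 1) ∘ₖ κ k) ≤ 1 - α

namespace IsCenteredChain

variable {Ω S : Type*} [m0 : MeasurableSpace Ω] [MeasurableSpace S] {P : Measure Ω}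
  [IsProbabilityMeasure P] {n : ℕ} {F : ℕ → MeasurableSpace Ω} {κ : ℕ → Kernel S S}
  [∀ k, IsMarkovKernel (κ k)] {X : ℕ → Ω → S} {f : ℕ → S → ℝ} {L α : ℝ}

lemma measurable_X (h : IsCenteredChain P n F κ X f L α) {k : ℕ} (hk : k ≤ n) :
    Measurable (X k) :=
  (h.adapted k k le_rfl hk).mono (h.le k hk) le_rfl

lemma integral_mul (h : IsCenteredChain P n F κ X f L α) {k : ℕ} (hk : k < n) {U : Ω → ℝ}
    (hU : @BddMeas Ω (F k) U) {g : S → ℝ} (hg : BddMeas g) :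
    ∫ ω, U ω * g (X (k + 1) ω) ∂P = ∫ ω, U ω * kerMean (κ k) g (X k ω) ∂P := by
  obtain ⟨C, hC⟩ := hU.2
  rw [← integral_mul_condExp (h.le k hk.le) P hU.1.stronglyMeasurable (Eventually.of_forall hC)
    ((hg.comp (h.measurable_X hk)).integrable P)]
  refine integral_congr_ae ?_
  filter_upwards [h.condExp k hk g hg] with ω hω
  rw [hω]

lemma integral_succ (h : IsCenteredChain P n F κ X f L α) {k : ℕ} (hk : k < n)
    {g : S → ℝ} (hg : BddMeas g) :
    ∫ ω, g (X (k + 1) ω) ∂P = ∫ ω, kerMean (κ k) g (X k ω) ∂P := by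
  simpa using h.integral_mul hk (@BddMeas.const Ω (F k) 1) hg

lemma bddMeas_tail (h : IsCenteredChain P n F κ X f L α) {k : ℕ} (hk : k ≤ n) :
    BddMeas (tailSum κ f n k) :=
  bddMeas_tailSum h.bddMeas k hk

lemma integral_tail (h : IsCenteredChain P n F κ X f L α) :
    ∀ k ≤ n, ∫ ω, tailSum κ f n k (X k ω) ∂P = 0 := by
  refine backward_induction n (by simp [tailSum_self]) fun k hk ih => ?_
  have hm : k + 1 ∈ Finset.Icc 1 n := by simp; omega
  rw [tailSum_of_lt hk, ← h.integral_succ hk ((h.bddMeas _ hm).add (h.bddMeas_tail hk)),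
    integral_add (((h.bddMeas _ hm).comp (h.measurable_X hk)).integrable P)
      (((h.bddMeas_tail hk).comp (h.measurable_X hk)).integrable P), h.centered _ hm, ih, add_zero]

lemma osc_tail (h : IsCenteredChain P n F κ X f L α) {k : ℕ} (hk : k ≤ n) (x y : S) :
    |tailSum κ f n k x - tailSum κ f n k y| ≤ 2 * L / α :=
  osc_tailSum_le h.bddMeas h.nonneg h.osc h.pos h.le_one h.delta k hk x y

/-- The oscillation bound is used under the law of Y on S, so that the conclusion holds at every
state, even one never visited. -/
lemma abs_le_of_centered {Y : Ω → S} (hY : Measurable Y) {g : S → ℝ} (hg : BddMeas g) {B : ℝ}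
    (hB : ∀ x y, |g x - g y| ≤ B) (h0 : ∫ ω, g (Y ω) ∂P = 0) (x : S) : |g x| ≤ B := by
  have : IsProbabilityMeasure (P.map Y) := Measure.isProbabilityMeasure_map hY.aemeasurable
  have := abs_sub_integral_le_of_osc (P.map Y) (hg.integrable _) hB x
  rwa [integral_map hY.aemeasurable hg.1.aestronglyMeasurable, h0, sub_zero] at this

lemma abs_tail_le (h : IsCenteredChain P n F κ X f L α) {k : ℕ} (hk : k ≤ n) (x : S) :
    |tailSum κ f n k x| ≤ 2 * L / α :=
  abs_le_of_centered (h.measurable_X hk) (h.bddMeas_tail hk) (h.osc_tail hk)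
    (h.integral_tail k hk) x

lemma abs_f_le (h : IsCenteredChain P n F κ X f L α) {i : ℕ} (hi : i ∈ Finset.Icc 1 n) (x : S) :
    |f i x| ≤ L :=
  abs_le_of_centered (h.measurable_X (Finset.mem_Icc.1 hi).2) (h.bddMeas i hi) (h.osc i hi)
    (h.centered i hi) x

/-- The function whose conditional future sums are the conditional second moments of future sums
of `f`. -/
noncomputable def sqTerm (κ : ℕ → Kernel S S) (f : ℕ → S → ℝ) (n i : ℕ) (x : S) : ℝ :=
  f i x ^ 2 + 2 * (f i x * tailSum κ f n i x)

/-- The conditional variance of `f (k + 1) (X (k + 1)) + ⋯ + f n (X n)` given `X k = x`. -/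
noncomputable def tailVar (κ : ℕ → Kernel S S) (f : ℕ → S → ℝ) (n k : ℕ) (x : S) : ℝ :=
  tailSum κ (sqTerm κ f n) n k x - tailSum κ f n k x ^ 2

lemma bddMeas_sqTerm (h : IsCenteredChain P n F κ X f L α) {i : ℕ} (hi : i ∈ Finset.Icc 1 n) :
    BddMeas (sqTerm κ f n i) :=
  (h.bddMeas i hi).sq.add ((BddMeas.const 2).mul
    ((h.bddMeas i hi).mul (h.bddMeas_tail (Finset.mem_Icc.1 hi).2)))

lemma bddMeas_tail_sqTerm (h : IsCenteredChain P n F κ X f L α) {k : ℕ} (hk : k ≤ n) :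
    BddMeas (tailSum κ (sqTerm κ f n) n k) :=
  bddMeas_tailSum (fun _ hi => h.bddMeas_sqTerm hi) k hk

lemma bddMeas_tailVar (h : IsCenteredChain P n F κ X f L α) {k : ℕ} (hk : k ≤ n) :
    BddMeas (tailVar κ f n k) :=
  (h.bddMeas_tail_sqTerm hk).sub (h.bddMeas_tail hk).sq

lemma le_div (h : IsCenteredChain P n F κ X f L α) : L ≤ L / α := by
  rw [le_div_iff₀ h.pos]
  nlinarith [h.nonneg, h.le_one]

lemma osc_sqTerm (h : IsCenteredChain P n F κ X f L α) {i : ℕ} (hi : i ∈ Finset.Icc 1 n)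
    (x y : S) : |sqTerm κ f n i x - sqTerm κ f n i y| ≤ 10 * L ^ 2 / α := by
  have hb : ∀ x, |sqTerm κ f n i x| ≤ 5 * L ^ 2 / α := by
    intro x
    have h1 := h.abs_f_le hi x
    have h2 := h.abs_tail_le (Finset.mem_Icc.1 hi).2 x
    unfold sqTerm
    have h3 : |f i x| * |tailSum κ f n i x| ≤ L * (2 * L / α) :=
      mul_le_mul h1 h2 (abs_nonneg _) h.nonneg
    have h4 : f i x ^ 2 ≤ L ^ 2 := sq_le_sq' (abs_le.1 h1).1 (abs_le.1 h1).2
    have h5 : L * L ≤ L * (L / α) := mul_le_mul_of_nonneg_left h.le_div h.nonneg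
    calc |f i x ^ 2 + 2 * (f i x * tailSum κ f n i x)|
        ≤ |f i x ^ 2| + |2 * (f i x * tailSum κ f n i x)| := abs_add_le _ _
      _ = f i x ^ 2 + 2 * (|f i x| * |tailSum κ f n i x|) := by
        rw [abs_mul, abs_mul, abs_two, abs_of_nonneg (sq_nonneg (f i x))]
      _ ≤ L * (L / α) + 2 * (L * (2 * L / α)) := by
        rw [← pow_two] at h5
        linarith
      _ = 5 * L ^ 2 / α := by ring
  calc _ ≤ |sqTerm κ f n i x| + |sqTerm κ f n i y| := abs_sub _ _
    _ ≤ 5 * L ^ 2 / α + 5 * L ^ 2 / α := add_le_add (hb x) (hb y)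
    _ = _ := by ring

/-- The tail of `sqTerm` contributes 2 · 10 (L/α)² and the squared tail of `f` contributes 4 (L/α)².
The total 24 is rounded up to 25, so that the constant 5 L / α also serves for the martingale
increments. -/
lemma osc_tailVar (h : IsCenteredChain P n F κ X f L α) {k : ℕ} (hk : k ≤ n) (x y : S) :
    |tailVar κ f n k x - tailVar κ f n k y| ≤ (5 * L / α) ^ 2 := by
  have hα := h.pos
  have h1 := osc_tailSum_le (κ := κ) (fun _ hi => h.bddMeas_sqTerm hi) (by positivity)
    (fun _ hi => h.osc_sqTerm hi) h.pos h.le_one h.delta k hk x y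
  have h2 : ∀ x, tailSum κ f n k x ^ 2 ≤ (2 * L / α) ^ 2 := fun x =>
    sq_le_sq' (abs_le.1 (h.abs_tail_le hk x)).1 (abs_le.1 (h.abs_tail_le hk x)).2
  have h3 : |tailSum κ f n k y ^ 2 - tailSum κ f n k x ^ 2| ≤ (2 * L / α) ^ 2 := by
    rw [abs_sub_le_iff]
    constructor <;> linarith [h2 x, h2 y, sq_nonneg (tailSum κ f n k x),
      sq_nonneg (tailSum κ f n k y)]
  have e : tailVar κ f n k x - tailVar κ f n k y
      = (tailSum κ (sqTerm κ f n) n k x - tailSum κ (sqTerm κ f n) n k y)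
        + (tailSum κ f n k y ^ 2 - tailSum κ f n k x ^ 2) := by
    unfold tailVar; ring
  rw [e]
  refine (abs_add_le _ _).trans ((add_le_add h1 h3).trans ?_)
  have e2 : 2 * (10 * L ^ 2 / α) / α + (2 * L / α) ^ 2 = 24 * (L / α) ^ 2 := by
    field_simp; ring
  rw [e2]
  have : (5 * L / α) ^ 2 = 25 * (L / α) ^ 2 := by ring
  rw [this]
  nlinarith [sq_nonneg (L / α)]

/-- `f (k + 1)` plus the conditional expectation of the subsequent sum. -/
noncomputable def headTail (κ : ℕ → Kernel S S) (f : ℕ → S → ℝ) (n k : ℕ) (y : S) : ℝ :=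
  f (k + 1) y + tailSum κ f n (k + 1) y

lemma bddMeas_headTail (h : IsCenteredChain P n F κ X f L α) {k : ℕ} (hk : k < n) :
    BddMeas (headTail κ f n k) :=
  (h.bddMeas (k + 1) (by simp; omega)).add (h.bddMeas_tail hk)

lemma kerMean_headTail {k : ℕ} (hk : k < n) :
    kerMean (κ k) (headTail κ f n k) = tailSum κ f n k :=
  (tailSum_of_lt hk).symm

/-- The squared tail in (f + T)² cancels the one subtracted in `tailVar`, leaving f² + 2 f T plus
the tail of `sqTerm`. -/
lemma kerMean_headTail_sq {k : ℕ} (hk : k < n) :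
    kerMean (κ k) (fun y => headTail κ f n k y ^ 2 + tailVar κ f n (k + 1) y)
      = tailSum κ (sqTerm κ f n) n k := by
  rw [tailSum_of_lt hk]
  congr 1
  ext y
  unfold headTail tailVar sqTerm
  ring

/-- This is the law of total variance for one step; nonnegativity of `tailVar` follows from it by
backward induction. -/
lemma tailVar_eq (h : IsCenteredChain P n F κ X f L α) {k : ℕ} (hk : k < n) (x : S) :
    tailVar κ f n k x = ∫ y, ((headTail κ f n k y - tailSum κ f n k x) ^ 2
      + tailVar κ f n (k + 1) y) ∂(κ k x) := by
  have b1 := h.bddMeas_headTail hk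
  have b2 := b1.sq.add (h.bddMeas_tailVar hk)
  have e : ∀ y, (headTail κ f n k y - tailSum κ f n k x) ^ 2 + tailVar κ f n (k + 1) y
      = (headTail κ f n k y ^ 2 + tailVar κ f n (k + 1) y)
        - (2 * tailSum κ f n k x) * headTail κ f n k y + tailSum κ f n k x ^ 2 := fun y => by ring
  simp_rw [e]
  rw [integral_add ((b2.sub ((BddMeas.const _).mul b1)).integrable _) (integrable_const _),
    integral_sub (b2.integrable _) (((BddMeas.const _).mul b1).integrable _), integral_const_mul]
  have e1 : ∫ y, headTail κ f n k y ∂(κ k x) = tailSum κ f n k x :=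
    congrFun (kerMean_headTail hk) x
  have e2 : ∫ y, (headTail κ f n k y ^ 2 + tailVar κ f n (k + 1) y) ∂(κ k x)
      = tailSum κ (sqTerm κ f n) n k x := congrFun (kerMean_headTail_sq hk) x
  rw [e1, e2, tailVar]
  simp
  ring

lemma tailVar_self (x : S) : tailVar κ f n n x = 0 := by simp [tailVar, tailSum_self]

lemma tailVar_nonneg (h : IsCenteredChain P n F κ X f L α) :
    ∀ k ≤ n, ∀ x, 0 ≤ tailVar κ f n k x := by
  refine backward_induction n (fun x => (tailVar_self x).ge) fun k hk ih x => ?_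
  rw [h.tailVar_eq hk]
  exact integral_nonneg fun y => add_nonneg (sq_nonneg _) (ih y)

lemma integral_mul_var (h : IsCenteredChain P n F κ X f L α) {k : ℕ} (hk : k < n) {U : Ω → ℝ}
    (hU : @BddMeas Ω (F k) U) :
    ∫ ω, U ω * ((headTail κ f n k (X (k + 1) ω) - tailSum κ f n k (X k ω)) ^ 2
      + tailVar κ f n (k + 1) (X (k + 1) ω) - tailVar κ f n k (X k ω)) ∂P = 0 := by
  have b1 := h.bddMeas_headTail hk
  have b2 := b1.sq.add (h.bddMeas_tailVar hk)
  have hX := h.measurable_X hk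
  have hX0 := h.measurable_X hk.le
  have bt := (h.bddMeas_tail hk.le)
  have bt' : @BddMeas Ω (F k) fun ω => tailSum κ f n k (X k ω) :=
    @BddMeas.comp Ω (F k) S _ _ bt _ (h.adapted k k le_rfl hk.le)
  have hU2 : @BddMeas Ω (F k) fun ω => U ω * tailSum κ f n k (X k ω) := @BddMeas.mul Ω (F k) _ _ hU bt'
  have e1 := h.integral_mul hk hU b2
  have e2 := h.integral_mul hk hU2 b1
  rw [kerMean_headTail_sq hk] at e1
  rw [kerMean_headTail hk] at e2
  have hU' := hU.mono (h.le k hk.le)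
  have e : ∀ ω, U ω * ((headTail κ f n k (X (k + 1) ω) - tailSum κ f n k (X k ω)) ^ 2
      + tailVar κ f n (k + 1) (X (k + 1) ω) - tailVar κ f n k (X k ω))
      = (U ω * (headTail κ f n k (X (k + 1) ω) ^ 2 + tailVar κ f n (k + 1) (X (k + 1) ω))
        - U ω * tailSum κ (sqTerm κ f n) n k (X k ω))
        - 2 * (U ω * tailSum κ f n k (X k ω) * headTail κ f n k (X (k + 1) ω)
          - U ω * tailSum κ f n k (X k ω) * tailSum κ f n k (X k ω)) := fun ω => by
    simp only [tailVar]
    ring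
  simp_rw [e]
  have i1 := hU'.mul (b2.comp hX)
  have i2 := hU'.mul ((h.bddMeas_tail_sqTerm hk.le).comp hX0)
  have i3 := (hU'.mul (bt.comp hX0)).mul (b1.comp hX)
  have i4 := (hU'.mul (bt.comp hX0)).mul (bt.comp hX0)
  rw [integral_sub ((i1.sub i2).integrable P) (((BddMeas.const 2).mul (i3.sub i4)).integrable P),
    integral_const_mul, integral_sub (i1.integrable P) (i2.integrable P),
    integral_sub (i3.integrable P) (i4.integrable P), e1, e2]
  simp

lemma integral_headTail_sq_sub (h : IsCenteredChain P n F κ X f L α) {k : ℕ} (hk : k < n) :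
    ∫ ω, tailVar κ f n k (X k ω) ∂P - ∫ ω, tailVar κ f n (k + 1) (X (k + 1) ω) ∂P
      = ∫ ω, headTail κ f n k (X (k + 1) ω) ^ 2 ∂P - ∫ ω, tailSum κ f n k (X k ω) ^ 2 ∂P := by
  have b1 := h.bddMeas_headTail hk
  have b2 := b1.sq.add (h.bddMeas_tailVar hk)
  have hX := h.measurable_X hk
  have hX0 := h.measurable_X hk.le
  have e1 := h.integral_succ hk b2
  rw [kerMean_headTail_sq hk, integral_add ((b1.sq.comp hX).integrable P)
    (((h.bddMeas_tailVar hk).comp hX).integrable P)] at e1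
  have e2 : ∫ ω, tailVar κ f n k (X k ω) ∂P
      = ∫ ω, tailSum κ (sqTerm κ f n) n k (X k ω) ∂P - ∫ ω, tailSum κ f n k (X k ω) ^ 2 ∂P :=
    integral_sub (((h.bddMeas_tail_sqTerm hk.le).comp hX0).integrable P)
      (((h.bddMeas_tail hk.le).sq.comp hX0).integrable P)
  rw [e2, ← e1]
  ring

lemma integral_tail_sq_le (h : IsCenteredChain P n F κ X f L α) {k : ℕ} (hk : k < n) :
    ∫ ω, tailSum κ f n k (X k ω) ^ 2 ∂P
      ≤ mdDelta (κ k) * ∫ ω, headTail κ f n k (X (k + 1) ω) ^ 2 ∂P := by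
  rw [← kerMean_headTail hk]
  refine integral_kerMean_sq_le (h.measurable_X hk.le) (h.measurable_X hk) (κ k)
    (fun g hg => ?_) (h.bddMeas_headTail hk) ?_
  -- The variance contraction conditions on X_k alone; the tower property descends from `F k`, since
  -- the conditional mean is a function of X_k.
  · have hle : MeasurableSpace.comap (X k) inferInstance ≤ F k :=
      (h.adapted k k le_rfl hk.le).comap_le
    refine (condExp_condExp_of_le hle (h.le k hk.le)).symm.trans ?_
    refine (condExp_congr_ae (h.condExp k hk g hg)).trans ?_
    have hb := hg.kerMean (κ k)
    have e := condExp_of_stronglyMeasurable (f := fun ω => kerMean (κ k) g (X k ω)) (hle.trans (h.le k hk.le))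
      (hb.1.comp (comap_measurable (X k))).stronglyMeasurable
      ((hb.comp (h.measurable_X hk.le)).integrable P)
    rw [e]
  · rw [h.integral_succ hk (h.bddMeas_headTail hk), kerMean_headTail hk, h.integral_tail k hk.le]

/-- The lower bound for the variance. -/
lemma le_integral_tailVar (h : IsCenteredChain P n F κ X f L α) {a c : ℝ} (ha : 0 ≤ a)
    (hδ : ∀ k < n, mdDelta (κ k) ≤ 1 - a)
    (hc : ∀ i ∈ Finset.Icc 1 n, c ≤ ∫ ω, f i (X i ω) ^ 2 ∂P) :
    a * n * c / 4 ≤ ∫ ω, tailVar κ f n 0 (X 0 ω) ∂P := by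
  set e : ℕ → ℝ := fun k => ∫ ω, headTail κ f n k (X (k + 1) ω) ^ 2 ∂P with he
  set γ : ℕ → ℝ := fun k => ∫ ω, tailSum κ f n k (X k ω) ^ 2 ∂P with hγ
  have he0 : ∀ k, 0 ≤ e k := fun k => integral_nonneg fun _ => sq_nonneg _
  have hV : ∫ ω, tailVar κ f n 0 (X 0 ω) ∂P = ∑ k ∈ Finset.range n, (e k - γ k) := by
    rw [← Finset.sum_congr rfl fun k hk => h.integral_headTail_sq_sub (Finset.mem_range.1 hk),
      Finset.sum_range_sub' (fun k => ∫ ω, tailVar κ f n k (X k ω) ∂P)]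
    simp [tailVar_self]
  have hγe : ∀ k < n, γ k ≤ (1 - a) * e k := fun k hk =>
    (h.integral_tail_sq_le hk).trans (mul_le_mul_of_nonneg_right (hδ k hk) (he0 k))
  -- From f = headTail - T and (a - b)² ≤ 2 a² + 2 b². The shift of index in γ is harmless after
  -- summation, because γ n = 0 and γ 0 ≥ 0.
  have hce : ∀ k < n, c ≤ 2 * e k + 2 * γ (k + 1) := by
    intro k hk
    have hm : k + 1 ∈ Finset.Icc 1 n := by simp; omega
    have hX := h.measurable_X hk
    have b1 := ((h.bddMeas_headTail hk).comp hX).sq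
    have b2 := ((h.bddMeas_tail hk).comp hX).sq
    refine (hc _ hm).trans ?_
    rw [he, hγ]
    simp only
    rw [← integral_const_mul, ← integral_const_mul, ← integral_add
      (((BddMeas.const 2).mul b1).integrable P) (((BddMeas.const 2).mul b2).integrable P)]
    refine integral_mono (((h.bddMeas _ hm).comp hX).sq.integrable P)
      ((((BddMeas.const 2).mul b1).add ((BddMeas.const 2).mul b2)).integrable P) fun ω => ?_
    simp only [headTail]
    nlinarith [sq_nonneg (f (k + 1) (X (k + 1) ω) + 2 * tailSum κ f n (k + 1) (X (k + 1) ω))]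
  have hsum : n * c ≤ 2 * ∑ k ∈ Finset.range n, e k + 2 * ∑ k ∈ Finset.range n, γ (k + 1) := by
    rw [Finset.mul_sum, Finset.mul_sum, ← Finset.sum_add_distrib]
    calc (n : ℝ) * c = ∑ _k ∈ Finset.range n, c := by simp
      _ ≤ _ := Finset.sum_le_sum fun k hk => hce k (Finset.mem_range.1 hk)
  have hshift : ∑ k ∈ Finset.range n, γ (k + 1) ≤ ∑ k ∈ Finset.range n, γ k := by
    have h1 := Finset.sum_range_succ γ n
    rw [Finset.sum_range_succ'] at h1
    have h2 : γ n = 0 := by simp [hγ, tailSum_self]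
    have h3 : 0 ≤ γ 0 := integral_nonneg fun _ => sq_nonneg _
    linarith
  have hγs : ∑ k ∈ Finset.range n, γ k ≤ (1 - a) * ∑ k ∈ Finset.range n, e k := by
    rw [Finset.mul_sum]
    exact Finset.sum_le_sum fun k hk => hγe k (Finset.mem_range.1 hk)
  have hes : 0 ≤ ∑ k ∈ Finset.range n, e k := Finset.sum_nonneg fun k _ => he0 k
  rw [hV, Finset.sum_sub_distrib]
  -- By `hγs`, Σγ ≤ Σe, so Σe ≥ n c / 4, while the variance Σ(e - γ) is at least a Σe.
  have h4 : n * c ≤ 4 * ∑ k ∈ Finset.range n, e k := by nlinarith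
  have h5 := mul_le_mul_of_nonneg_left h4 ha
  linarith

lemma eq_of_start (h : IsCenteredChain P n F κ X f L α) (hn : 0 < n) (g : ℕ → S → ℝ) (x y : S) :
    tailSum κ g n 0 x = tailSum κ g n 0 y := by
  rw [tailSum_of_lt hn, kerMean, kerMean, h.start x y]

/-- The constant first kernel makes the tail at time 0 a constant, and its mean is 0; hence the
martingale starts at 0. -/
lemma tail_zero (h : IsCenteredChain P n F κ X f L α) (hn : 0 < n) (x : S) :
    tailSum κ f n 0 x = 0 := by
  have h1 := h.integral_tail 0 hn.le
  have : ∀ ω, tailSum κ f n 0 (X 0 ω) = tailSum κ f n 0 x := fun ω => h.eq_of_start hn f _ _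
  simp_rw [this] at h1
  simpa using h1

/-- The martingale approximating the partial sums. -/
noncomputable def mart (κ : ℕ → Kernel S S) (X : ℕ → Ω → S) (f : ℕ → S → ℝ) (n k : ℕ)
    (ω : Ω) : ℝ :=
  ∑ i ∈ Finset.Icc 1 k, f i (X i ω) + tailSum κ f n k (X k ω)

lemma mart_succ_sub (k : ℕ) (ω : Ω) : mart κ X f n (k + 1) ω - mart κ X f n k ω
    = headTail κ f n k (X (k + 1) ω) - tailSum κ f n k (X k ω) := by
  rw [mart, mart, Finset.sum_Icc_succ_top (by omega), headTail]
  ring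

lemma isAlmostNormalMartingale (h : IsCenteredChain P n F κ X f L α) (hn : 0 < n) {V : ℝ}
    (hV : ∫ ω, tailVar κ f n 0 (X 0 ω) ∂P = V) (hV0 : 0 < V) :
    IsAlmostNormalMartingale P n F (fun k ω => mart κ X f n k ω / √V)
      (fun k ω => tailVar κ f n k (X k ω) / V) (5 * L / α / √V) where
  le := h.le
  bddMeas_M k hk := by
    have hb : @BddMeas Ω (F k) (mart κ X f n k) := by
      refine @BddMeas.add Ω (F k) _ _ (@BddMeas.sum Ω (F k) ℕ _ _ fun i hi => ?_) ?_
      · have hi' := Finset.mem_Icc.1 hi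
        exact @BddMeas.comp Ω (F k) S _ _ (h.bddMeas i (by simp; omega)) _
          (h.adapted i k hi'.2 hk)
      · exact @BddMeas.comp Ω (F k) S _ _ (h.bddMeas_tail hk) _ (h.adapted k k le_rfl hk)
    simpa only [div_eq_mul_inv] using @BddMeas.mul Ω (F k) _ _ hb (@BddMeas.const Ω (F k) _)
  bddMeas_R k hk := by
    have hb := @BddMeas.comp Ω (F k) S _ _ (h.bddMeas_tailVar hk) _ (h.adapted k k le_rfl hk)
    simpa only [div_eq_mul_inv] using @BddMeas.mul Ω (F k) _ _ hb (@BddMeas.const Ω (F k) _)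
  M_zero ω := by simp [mart, h.tail_zero hn]
  R_last ω := by simp [tailVar_self]
  R_nonneg k hk ω := div_nonneg (h.tailVar_nonneg k hk _) hV0.le
  increment k hk ω := by
    rw [← sub_div, abs_div, abs_of_nonneg (Real.sqrt_nonneg V), mart_succ_sub]
    refine div_le_div_of_nonneg_right ?_ (Real.sqrt_nonneg V)
    have h1 := h.abs_f_le (i := k + 1) (by simp; omega) (X (k + 1) ω)
    have h2 := h.abs_tail_le hk (X (k + 1) ω)
    have h3 := h.abs_tail_le hk.le (X k ω)
    have e : 5 * L / α = L / α + (2 * L / α) + (2 * L / α) := by ring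
    rw [e, headTail]
    have h4 := h.le_div
    exact (abs_sub _ _).trans (add_le_add ((abs_add_le _ _).trans
      (add_le_add (h1.trans h4) h2)) h3)
  osc k hk ω ω' := by
    rw [← sub_div, abs_div, abs_of_pos hV0, div_pow, Real.sq_sqrt hV0.le]
    exact div_le_div_of_nonneg_right (h.osc_tailVar hk _ _) hV0.le
  integral_R := by
    rw [integral_div, hV, div_self hV0.ne']
  mart k hk U hU := by
    have e : ∀ ω, U ω * (mart κ X f n (k + 1) ω / √V - mart κ X f n k ω / √V)
        = (√V)⁻¹ * (U ω * headTail κ f n k (X (k + 1) ω) - U ω * tailSum κ f n k (X k ω)) :=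
      fun ω => by
        rw [← sub_div, mart_succ_sub]
        ring
    have hU' := hU.mono (h.le k hk.le)
    have e1 := h.integral_mul hk hU (h.bddMeas_headTail hk)
    rw [kerMean_headTail hk] at e1
    simp_rw [e]
    rw [integral_const_mul, integral_sub
      ((hU'.mul ((h.bddMeas_headTail hk).comp (h.measurable_X hk))).integrable P)
      ((hU'.mul ((h.bddMeas_tail hk.le).comp (h.measurable_X hk.le))).integrable P), e1]
    simp
  var k hk U hU := by
    have e : ∀ ω, U ω * ((mart κ X f n (k + 1) ω / √V - mart κ X f n k ω / √V) ^ 2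
        + tailVar κ f n (k + 1) (X (k + 1) ω) / V - tailVar κ f n k (X k ω) / V)
        = V⁻¹ * (U ω * ((headTail κ f n k (X (k + 1) ω) - tailSum κ f n k (X k ω)) ^ 2
          + tailVar κ f n (k + 1) (X (k + 1) ω) - tailVar κ f n k (X k ω))) := fun ω => by
      rw [← sub_div, mart_succ_sub, div_pow, Real.sq_sqrt hV0.le]
      ring
    simp_rw [e]
    rw [integral_const_mul, h.integral_mul_var hk hU, mul_zero]

lemma mart_last (ω : Ω) : mart κ X f n n ω = ∑ i ∈ Finset.Icc 1 n, f i (X i ω) := by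
  rw [mart, tailSum_self, add_zero]

lemma integral_sum_sq (h : IsCenteredChain P n F κ X f L α) (hn : 0 < n)
    (hV0 : 0 < ∫ ω, tailVar κ f n 0 (X 0 ω) ∂P) :
    ∫ ω, (∑ i ∈ Finset.Icc 1 n, f i (X i ω)) ^ 2 ∂P = ∫ ω, tailVar κ f n 0 (X 0 ω) ∂P := by
  have := (h.isAlmostNormalMartingale hn rfl hV0).integral_M_sq_add le_rfl
  simp only [mart_last, tailVar_self, zero_div, add_zero, div_pow, Real.sq_sqrt hV0.le] at this
  rwa [integral_div, div_eq_one_iff_eq hV0.ne'] at this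

end IsCenteredChain

/-! ### From transition probabilities to conditional expectations. -/

section Transition

variable {Ω S : Type*} [MeasurableSpace S]

lemma integral_bind_kernel (ν : Measure S) [IsFiniteMeasure ν] (κ : Kernel S S) [IsMarkovKernel κ]
    {g : S → ℝ} (hg : BddMeas g) : ∫ y, g y ∂(κ ∘ₘ ν) = ∫ x, kerMean κ g x ∂ν := by
  have e : κ ∘ₘ ν = (κ ∘ₖ Kernel.const Unit ν) () := by
    rw [Kernel.comp_apply, Kernel.const_apply]
  rw [e, Kernel.integral_comp (hg.integrable _), Kernel.const_apply]
  rfl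

/-- Transition probabilities determine conditional expectations of bounded functions. -/
lemma condExp_comp_eq_kerMean {m m0 : MeasurableSpace Ω} (hm : m ≤ m0) {P : Measure Ω}
    [IsProbabilityMeasure P] {X Y : Ω → S} (hX : Measurable[m] X) (hY : Measurable Y)
    (κ : Kernel S S) [IsMarkovKernel κ]
    (h : ∀ A : Set S, MeasurableSet A → P[(Y ⁻¹' A).indicator (fun _ => (1 : ℝ)) | m]
      =ᵐ[P] fun ω => (κ (X ω)).real A) {g : S → ℝ} (hg : BddMeas g) :
    P[fun ω => g (Y ω) | m] =ᵐ[P] fun ω => kerMean κ g (X ω) := by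
  have hX' : Measurable X := hX.mono hm le_rfl
  have hk := hg.kerMean κ
  refine (ae_eq_condExp_of_forall_setIntegral_eq hm ((hg.comp hY).integrable P)
    (fun s _ _ => ((hk.comp hX').integrable P).integrableOn) (fun s hs _ => ?_)
    (hk.1.comp hX).stronglyMeasurable.aestronglyMeasurable).symm
  -- An equality of measures on S, checked on sets for each event s of the past, passes from sets to
  -- all bounded functions at once.
  have key : (P.restrict s).map Y = κ ∘ₘ (P.restrict s).map X := by
    ext A hA
    have hbA : BddMeas fun x => (κ x).real A :=
      ⟨(κ.measurable_coe hA).ennreal_toReal, 1, fun x => by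
        rw [abs_of_nonneg measureReal_nonneg]; exact measureReal_le_one⟩
    rw [Measure.bind_apply hA κ.aemeasurable, lintegral_map (κ.measurable_coe hA) hX',
      Measure.map_apply hY hA]
    have e1 : ∀ ω, κ (X ω) A = ENNReal.ofReal ((κ (X ω)).real A) := fun ω => by
      rw [Measure.real, ENNReal.ofReal_toReal (measure_ne_top _ _)]
    simp_rw [e1]
    rw [← ofReal_integral_eq_lintegral_ofReal ((hbA.comp hX').integrable _)
      (Eventually.of_forall fun ω => measureReal_nonneg)]
    have e2 : ∫ ω in s, (κ (X ω)).real A ∂P = (P.restrict s).real (Y ⁻¹' A) := by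
      rw [← setIntegral_congr_ae (hm s hs) ((h A hA).mono fun ω hω _ => hω),
        setIntegral_condExp hm ((integrable_const (1 : ℝ)).indicator (hY hA)) hs,
        integral_indicator (hY hA)]
      simp
    rw [e2, Measure.real, ENNReal.ofReal_toReal (measure_ne_top _ _)]
  calc ∫ ω in s, kerMean κ g (X ω) ∂P = ∫ x, kerMean κ g x ∂(P.restrict s).map X :=
        (integral_map hX'.aemeasurable hk.1.aestronglyMeasurable).symm
    _ = ∫ y, g y ∂(P.restrict s).map Y := by rw [key, integral_bind_kernel _ _ hg]
    _ = _ := integral_map hY.aemeasurable hg.1.aestronglyMeasurable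

end Transition

/-! ### Prefixing a deterministic time 0, so that the initial law becomes a transition. -/

section Extension

variable {Ω S : Type*} [MeasurableSpace S]

/-- The kernels `κ`, preceded at time `0` by the constant kernel `μ`. -/
noncomputable def extKernel (μ : Measure S) (κ : ℕ → Kernel S S) : ℕ → Kernel S S
  | 0 => Kernel.const S μ
  | k + 1 => κ (k + 1)

instance (μ : Measure S) [IsProbabilityMeasure μ] (κ : ℕ → Kernel S S)
    [∀ i, IsMarkovKernel (κ i)] (k : ℕ) : IsMarkovKernel (extKernel μ κ k) := by
  cases k <;> unfold extKernel <;> infer_instance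

/-- The process `X`, preceded by the deterministic state `x₀` at time `0`. -/
def extProcess (x₀ : S) (X : ℕ → Ω → S) : ℕ → Ω → S
  | 0 => fun _ => x₀
  | k + 1 => X (k + 1)

lemma extProcess_of_pos (x₀ : S) (X : ℕ → Ω → S) {k : ℕ} (hk : 1 ≤ k) :
    extProcess x₀ X k = X k := by
  obtain ⟨j, rfl⟩ := Nat.exists_eq_add_of_le' hk
  rfl

/-- The `σ`-algebra generated by `X 1, …, X k`. -/
abbrev history (X : ℕ → Ω → S) (k : ℕ) : MeasurableSpace Ω :=
  ⨆ j ∈ Finset.Icc 1 k, MeasurableSpace.comap (X j) inferInstance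

variable [m0 : MeasurableSpace Ω]

lemma mdDelta_comp_extKernel_zero (μ : Measure S) (κ : ℕ → Kernel S S) :
    mdDelta (extKernel μ κ 1 ∘ₖ extKernel μ κ 0) = 0 := by
  refine le_antisymm (mdDelta_le _ le_rfl fun x y A _ => ?_) (mdDelta_nonneg _)
  rw [Kernel.comp_apply, Kernel.comp_apply]
  simp [extKernel]

lemma mdDelta_extKernel_zero (μ : Measure S) (κ : ℕ → Kernel S S) :
    mdDelta (extKernel μ κ 0) = 0 :=
  le_antisymm (mdDelta_le _ le_rfl fun x y A _ => by simp [extKernel]) (mdDelta_nonneg _)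

lemma alphaOne_le {n : ℕ} (κ : ℕ → Kernel S S) {i : ℕ} (hi : 1 ≤ i) (hin : i + 1 ≤ n) :
    alphaOne n κ ≤ mdAlpha (κ i) :=
  ciInf_le (f := fun i : Set.Icc 1 (n - 1) => mdAlpha (κ i)) (Set.finite_range _).bddBelow
    ⟨i, hi, by omega⟩

lemma alphaTwo_le {n : ℕ} (κ : ℕ → Kernel S S) {i : ℕ} (hi : 1 ≤ i) (hin : i + 2 ≤ n) :
    alphaTwo n κ ≤ mdAlpha (κ (i + 1) ∘ₖ κ i) :=
  ciInf_le (f := fun i : Set.Icc 1 (n - 2) => mdAlpha (κ ((i : ℕ) + 1) ∘ₖ κ i))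
    (Set.finite_range _).bddBelow ⟨i, hi, by omega⟩

lemma alphaOne_nonneg {n : ℕ} (κ : ℕ → Kernel S S) [∀ i, IsMarkovKernel (κ i)] :
    0 ≤ alphaOne n κ :=
  Real.iInf_nonneg fun _ => sub_nonneg.2 (mdDelta_le_one _)

lemma alphaTwo_nonneg {n : ℕ} (κ : ℕ → Kernel S S) [∀ i, IsMarkovKernel (κ i)] :
    0 ≤ alphaTwo n κ :=
  Real.iInf_nonneg fun _ => sub_nonneg.2 (mdDelta_le_one _)

lemma mdAlpha_le_one (κ : Kernel S S) : mdAlpha κ ≤ 1 := by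
  have := mdDelta_nonneg κ
  unfold mdAlpha
  linarith

end Extension

/-! ### The central limit theorem. -/

namespace IsMarkovChain

variable {Ω S : Type*} [m0 : MeasurableSpace Ω] [MeasurableSpace S] {P : Measure Ω}
  [IsProbabilityMeasure P] {n : ℕ} {μ : Measure S} {κ : ℕ → Kernel S S}
  [∀ i, IsMarkovKernel (κ i)] {X : ℕ → Ω → S} {f : ℕ → S → ℝ} {K : ℝ}

lemma isProbabilityMeasure_initial (h : IsMarkovChain P n μ κ X) (hn : 1 ≤ n) :
    IsProbabilityMeasure μ := by
  rw [← h.initial]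
  exact Measure.isProbabilityMeasure_map (h.measurable 1 (by simp; omega)).aemeasurable

lemma history_le (h : IsMarkovChain P n μ κ X) {k : ℕ} (hk : k ≤ n) : history X k ≤ m0 :=
  iSup₂_le fun j hj => (h.measurable j (by simp at hj ⊢; omega)).comap_le

lemma measurable_history {i k : ℕ} (hi : 1 ≤ i) (hik : i ≤ k) : Measurable[history X k] (X i) :=
  Measurable.mono (comap_measurable (X i))
    (le_iSup₂_of_le (f := fun j (_ : j ∈ Finset.Icc 1 k) =>
      MeasurableSpace.comap (X j) inferInstance) i (by simp; omega) le_rfl) le_rfl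

/-- Extended to time `0` and with centered functions, a Markov chain is a centered chain. -/
lemma isCenteredChain (h : IsMarkovChain P n μ κ X) (hn : 3 ≤ n) [IsProbabilityMeasure μ] (x₀ : S)
    (hf : ∀ i ∈ Finset.Icc 1 n, Measurable (f i))
    (hK : ∀ i ∈ Finset.Icc 1 n, ∀ x, |f i x| ≤ K) (hα : 0 < alphaTwo n κ) :
    IsCenteredChain P n (history X) (extKernel μ κ) (extProcess x₀ X)
      (fun i x => f i x - ∫ ω, f i (X i ω) ∂P) (2 * K) (alphaTwo n κ) where
  le k hk := h.history_le hk
  adapted i k hik hk := by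
    cases i with
    | zero => exact (measurable_const : Measurable[history X k] fun _ : Ω => x₀)
    | succ i => exact measurable_history (X := X) (i := i + 1) (by omega) hik
  condExp k hk g hg := by
    cases k with
    | zero =>
      -- The past at time 0 is trivial, so conditioning on it is plain expectation, that is,
      -- integration against the initial law.
      have e : history X 0 = ⊥ := by simp [history]
      have hX1 := h.measurable 1 (by simp; omega)
      rw [e, condExp_bot]
      refine Eventually.of_forall fun ω => ?_
      change ∫ ω, g (X 1 ω) ∂P = kerMean (Kernel.const S μ) g x₀
      rw [kerMean, Kernel.const_apply, ← h.initial,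
        integral_map hX1.aemeasurable hg.1.aestronglyMeasurable]
    | succ k =>
      exact condExp_comp_eq_kerMean (h.history_le (by omega))
        (measurable_history (X := X) (i := k + 1) (by omega) le_rfl) (h.measurable _ (by simp; omega)) (κ (k + 1))
        (h.transition (k + 1) (by omega) (by omega)) hg
  start x y := by simp [extKernel]
  bddMeas i hi := (show BddMeas (f i) from ⟨hf i hi, K, hK i hi⟩).sub (BddMeas.const _)
  osc i hi x y := by
    have h1 := abs_le.1 (hK i hi x)
    have h2 := abs_le.1 (hK i hi y)
    rw [sub_sub_sub_cancel_right, abs_le]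
    constructor <;> linarith
  centered i hi := by
    rw [extProcess_of_pos x₀ X (Finset.mem_Icc.1 hi).1, integral_sub
      (((show BddMeas (f i) from ⟨hf i hi, K, hK i hi⟩).comp (h.measurable i hi)).integrable P)
      (integrable_const _)]
    simp
  nonneg := by
    have := (abs_nonneg _).trans (hK 1 (by simp; omega) x₀)
    linarith
  pos := hα
  le_one := (alphaTwo_le κ le_rfl hn).trans (mdAlpha_le_one _)
  delta k hk := by
    cases k with
    | zero =>
      rw [mdDelta_comp_extKernel_zero]
      linarith [(alphaTwo_le κ le_rfl hn).trans (mdAlpha_le_one _)]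
    | succ k =>
      have : alphaTwo n κ ≤ 1 - mdDelta (κ (k + 1 + 1) ∘ₖ κ (k + 1)) :=
        alphaTwo_le κ (i := k + 1) (by omega) (by omega)
      change mdDelta (κ (k + 1 + 1) ∘ₖ κ (k + 1)) ≤ _
      linarith

lemma bddMeas_comp (h : IsMarkovChain P n μ κ X)
    (hf : ∀ i ∈ Finset.Icc 1 n, Measurable (f i))
    (hK : ∀ i ∈ Finset.Icc 1 n, ∀ x, |f i x| ≤ K) {i : ℕ} (hi : i ∈ Finset.Icc 1 n) :
    BddMeas fun ω => f i (X i ω) :=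
  (show BddMeas (f i) from ⟨hf i hi, K, hK i hi⟩).comp (h.measurable i hi)

lemma chainSum_sub_integral (h : IsMarkovChain P n μ κ X)
    (hf : ∀ i ∈ Finset.Icc 1 n, Measurable (f i))
    (hK : ∀ i ∈ Finset.Icc 1 n, ∀ x, |f i x| ≤ K) (x₀ : S) (ω : Ω) :
    chainSum n f X ω - ∫ ω', chainSum n f X ω' ∂P
      = ∑ i ∈ Finset.Icc 1 n, (f i (extProcess x₀ X i ω) - ∫ ω, f i (X i ω) ∂P) := by
  unfold chainSum
  rw [integral_finsetSum _ fun i hi => (h.bddMeas_comp hf hK hi).integrable P,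
    ← Finset.sum_sub_distrib]
  refine Finset.sum_congr rfl fun i hi => ?_
  rw [extProcess_of_pos x₀ X (Finset.mem_Icc.1 hi).1]

lemma measurable_chainSum (h : IsMarkovChain P n μ κ X)
    (hf : ∀ i ∈ Finset.Icc 1 n, Measurable (f i)) : Measurable (chainSum n f X) := by
  unfold chainSum
  exact Finset.measurable_sum _ fun i hi => (hf i hi).comp (h.measurable i hi)

/-- A quantitative central limit theorem for characteristic functions. -/
theorem norm_charFun_sub_le (h : IsMarkovChain P n μ κ X) (hn : 3 ≤ n)
    (hf : ∀ i ∈ Finset.Icc 1 n, Measurable (f i))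
    (hK : ∀ i ∈ Finset.Icc 1 n, ∀ x, |f i x| ≤ K) {c : ℝ} (hc : 0 < c)
    (hvar : ∀ i ∈ Finset.Icc 1 n, c ≤ Var[fun ω => f i (X i ω); P])
    (h1 : 0 < alphaOne n κ) (h2 : 0 < alphaTwo n κ) (t : ℝ) {η : ℝ} (hη : 0 < η)
    (hηK : 400 * K ^ 2 / (c * (n * alphaOne n κ * alphaTwo n κ ^ 2)) ≤ η ^ 2)
    (hL : |t| * η + 3 * t ^ 2 * η ^ 2 / 2 ≤ 1) :
    ‖charFun (P.map fun ω => (chainSum n f X ω - ∫ ω', chainSum n f X ω' ∂P)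
        / √(Var[chainSum n f X; P])) t - Complex.exp (-(t ^ 2 / 2 : ℝ))‖
      ≤ IsAlmostNormalMartingale.charFunError t η := by
  have hn0 : 0 < n := by omega
  have := h.isProbabilityMeasure_initial (by omega)
  obtain ⟨ω₀⟩ := nonempty_of_isProbabilityMeasure P
  set x₀ := X 1 ω₀
  have hch := h.isCenteredChain hn x₀ hf hK h2
  set V := ∫ ω, IsCenteredChain.tailVar (extKernel μ κ)
    (fun i x => f i x - ∫ ω, f i (X i ω) ∂P) n 0 (extProcess x₀ X 0 ω) ∂P with hVdef
  have hnpos : (0 : ℝ) < n := by exact_mod_cast hn0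
  have ha1 : alphaOne n κ ≤ 1 := (alphaOne_le κ le_rfl (by omega)).trans (mdAlpha_le_one _)
  have hVle : alphaOne n κ * n * c / 4 ≤ V := by
    refine hch.le_integral_tailVar h1.le (fun k hk => ?_) fun i hi => ?_
    · cases k with
      | zero => rw [mdDelta_extKernel_zero]; linarith
      | succ k =>
        have : alphaOne n κ ≤ 1 - mdDelta (κ (k + 1)) := alphaOne_le κ (by omega) hk
        change mdDelta (κ (k + 1)) ≤ _
        linarith
    · rw [extProcess_of_pos x₀ X (Finset.mem_Icc.1 hi).1]
      have := hvar i hi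
      rwa [variance_eq_integral (h.bddMeas_comp hf hK hi).1.aemeasurable] at this
  have hV0 : 0 < V := lt_of_lt_of_le (by positivity) hVle
  have hsum := h.chainSum_sub_integral hf hK x₀
  have hVar : Var[chainSum n f X; P] = V := by
    rw [variance_eq_integral (h.measurable_chainSum hf).aemeasurable]
    simp_rw [hsum]
    exact hch.integral_sum_sq hn0 hV0
  have hmart := hch.isAlmostNormalMartingale hn0 rfl hV0
  rw [← hVdef] at hmart
  have hK0 : 0 ≤ K := (abs_nonneg _).trans (hK 1 (by simp; omega) x₀)
  have hη0 : 0 ≤ 5 * (2 * K) / alphaTwo n κ / √V := by positivity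
  have hη' : 5 * (2 * K) / alphaTwo n κ / √V ≤ η := by
    refine (sq_le_sq₀ hη0 hη.le).1 ?_
    refine le_trans ?_ hηK
    -- The 400 is 10² · 4: centered functions oscillate by at most L = 2K, increments are bounded
    -- through 5L = 10K, and V ≥ α_n n c / 4.
    rw [div_pow, Real.sq_sqrt hV0.le, div_pow, div_div]
    calc (5 * (2 * K)) ^ 2 / (alphaTwo n κ ^ 2 * V)
        ≤ (5 * (2 * K)) ^ 2 / (alphaTwo n κ ^ 2 * (alphaOne n κ * n * c / 4)) := by gcongr
      _ = _ := by field_simp; ring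
  have hfin := (hmart.mono hη0 hη').norm_charFun_sub_le hη t hL
  rw [hVar, charFun_apply_real, integral_map
    (((h.measurable_chainSum hf).sub_const _).div_const _).aemeasurable (by fun_prop)]
  refine le_trans (le_of_eq ?_) hfin
  congr 2
  refine integral_congr_ae (Eventually.of_forall fun ω => ?_)
  simp only [IsCenteredChain.mart_last, hsum]
  push_cast
  rfl

end IsMarkovChain

/-- The central limit theorem for triangular arrays of Markov chains. -/
theorem tendstoInDistribution_chainSum {S : Type*} [MeasurableSpace S]
    {Ω : ℕ → Type*} [∀ n, MeasurableSpace (Ω n)]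
    (P : ∀ n, Measure (Ω n)) [∀ n, IsProbabilityMeasure (P n)]
    (μ : ℕ → Measure S) (κ : ℕ → ℕ → Kernel S S) [∀ n i, IsMarkovKernel (κ n i)]
    (X : ∀ n, ℕ → Ω n → S) (f : ℕ → ℕ → S → ℝ) (C : ℕ → ℝ) (c : ℝ)
    (hX : ∀ n, 1 ≤ n → IsMarkovChain (P n) n (μ n) (κ n) (X n))
    (hf : ∀ n, ∀ i ∈ Finset.Icc 1 n, Measurable (f n i))
    (hC : ∀ n, ∀ i ∈ Finset.Icc 1 n, ∀ x, |f n i x| ≤ C n)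
    (hCb : BddAbove (Set.range C)) (hc : 0 < c)
    (hvar : ∀ n, ∀ i ∈ Finset.Icc 1 n, c ≤ Var[fun ω => f n i (X n i ω); P n])
    (hlim : Tendsto (fun n : ℕ => (n : ℝ) * alphaOne n (κ n) * (alphaTwo n (κ n)) ^ 2)
      atTop atTop) :
    TendstoInDistribution
      (fun n ω => (chainSum n (f n) (X n) ω - ∫ ω', chainSum n (f n) (X n) ω' ∂(P n)) /
        √(Var[chainSum n (f n) (X n); P n]))
      atTop (id : ℝ → ℝ) P (gaussianReal 0 1) := by
  obtain ⟨K₀, hK₀⟩ := hCb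
  -- The maximum with 1 keeps η strictly positive.
  set K := max K₀ 1 with hKdef
  have hK : ∀ n, ∀ i ∈ Finset.Icc 1 n, ∀ x, |f n i x| ≤ K := fun n i hi x =>
    (hC n i hi x).trans ((hK₀ ⟨n, rfl⟩).trans (le_max_left _ _))
  have hmeas : ∀ n, Measurable (chainSum n (f n) (X n)) := by
    intro n
    rcases Nat.eq_zero_or_pos n with rfl | hn
    · have : chainSum 0 (f 0) (X 0) = fun _ => 0 := by ext; simp [chainSum]
      rw [this]
      exact measurable_const
    · exact (hX n hn).measurable_chainSum (hf n)
  refine ⟨fun n => (((hmeas n).sub_const _).div_const _).aemeasurable, aemeasurable_id, ?_⟩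
  refine ProbabilityMeasure.tendsto_iff_tendsto_charFun.2 fun t => ?_
  have e : charFun ((gaussianReal 0 1).map id) t = Complex.exp (-(t ^ 2 / 2 : ℝ)) := by
    rw [Measure.map_id, charFun_gaussianReal]
    simp
  simp only [ProbabilityMeasure.coe_mk]
  rw [e]
  set η : ℕ → ℝ := fun n =>
    √(400 * K ^ 2 / (c * ((n : ℝ) * alphaOne n (κ n) * (alphaTwo n (κ n)) ^ 2))) with hη
  have hηlim : Tendsto η atTop (𝓝 0) := by
    have h1 : Tendsto (fun n : ℕ => 400 * K ^ 2 /
        (c * ((n : ℝ) * alphaOne n (κ n) * (alphaTwo n (κ n)) ^ 2))) atTop (𝓝 0) :=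
      (hlim.const_mul_atTop hc).const_div_atTop _
    simpa using h1.sqrt
  rw [tendsto_iff_norm_sub_tendsto_zero]
  have hL : ∀ᶠ n in atTop, |t| * η n + 3 * t ^ 2 * η n ^ 2 / 2 ≤ 1 := by
    have hcont : Continuous fun x : ℝ => |t| * x + 3 * t ^ 2 * x ^ 2 / 2 := by fun_prop
    have h0 := (hcont.tendsto 0).comp hηlim
    simp only [mul_zero, ne_eq, OfNat.ofNat_ne_zero, not_false_eq_true, zero_pow, zero_div,
      add_zero] at h0
    exact (h0.eventually (gt_mem_nhds zero_lt_one)).mono fun n hn => le_of_lt hn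
  refine squeeze_zero' (Eventually.of_forall fun n => norm_nonneg _) ?_
    ((IsAlmostNormalMartingale.tendsto_charFunError t).comp hηlim)
  filter_upwards [hL, hlim.eventually_gt_atTop 0, eventually_ge_atTop 3] with n hLn hq hn
  have hnpos : (0 : ℝ) < n := by exact_mod_cast (by omega : 0 < n)
  -- Both coefficients are nonnegative, so positivity of the product in (c) forces each to be
  -- positive.
  have h2 : 0 < alphaTwo n (κ n) := by
    refine (alphaTwo_nonneg _).lt_of_ne fun h0 => ?_
    rw [← h0] at hq
    simp at hq
  have h1 : 0 < alphaOne n (κ n) := by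
    refine (alphaOne_nonneg _).lt_of_ne fun h0 => ?_
    rw [← h0] at hq
    simp at hq
  have hpos : 0 < 400 * K ^ 2 / (c * ((n : ℝ) * alphaOne n (κ n) * (alphaTwo n (κ n)) ^ 2)) := by
    positivity
  exact (hX n (by omega)).norm_charFun_sub_le hn (hf n) (hK n) hc (hvar n) h1 h2 t
    (Real.sqrt_pos.2 hpos) (Real.sq_sqrt hpos.le).ge hLn

/-! ### The example in which Dobrushin's condition fails. -/

namespace LazyShift

/-- The law of a pair of independent bits, the first of which is `true` with probability `p / 2`
and the second with probability `1 / 2`. -/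
noncomputable def bitWeight (p : unitInterval) (w : Bool × Bool) : ℝ :=
  (bif w.1 then (p : ℝ) / 2 else 1 - (p : ℝ) / 2) / 2

lemma bitWeight_nonneg (p : unitInterval) (w : Bool × Bool) : 0 ≤ bitWeight p w := by
  have h0 := p.2.1
  have h1 := p.2.2
  unfold bitWeight
  cases w.1 <;> simp <;> linarith

/-- The measure with weights `bitWeight`. -/
noncomputable def bitLaw (p : unitInterval) : Measure (Bool × Bool) :=
  ∑ w, ENNReal.ofReal (bitWeight p w) • Measure.dirac w

lemma sum_bool_prod (g : Bool × Bool → ℝ) :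
    ∑ w, g w = g (true, true) + g (true, false) + (g (false, true) + g (false, false)) := by
  rw [Fintype.sum_prod_type]
  simp

instance (p : unitInterval) : IsProbabilityMeasure (bitLaw p) := by
  refine ⟨?_⟩
  simp only [bitLaw, Measure.coe_finsetSum, Finset.sum_apply, Measure.smul_apply,
    measure_univ, smul_eq_mul, mul_one]
  rw [← ENNReal.ofReal_sum_of_nonneg fun w _ => bitWeight_nonneg p w, sum_bool_prod]
  simp only [bitWeight, cond_true, cond_false]
  rw [← ENNReal.ofReal_one]
  congr 1
  ring

lemma integral_bitLaw (p : unitInterval) (g : Bool × Bool → ℝ) :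
    ∫ w, g w ∂(bitLaw p) = ∑ w, bitWeight p w * g w := by
  have hi : ∀ w ∈ (Finset.univ : Finset (Bool × Bool)),
      Integrable g (ENNReal.ofReal (bitWeight p w) • Measure.dirac w) := fun w _ =>
    Integrable.of_finite.smul_measure ENNReal.ofReal_ne_top
  rw [bitLaw, integral_finsetSum_measure hi]
  simp [integral_smul_measure, ENNReal.toReal_ofReal (bitWeight_nonneg p _)]

variable {k : ℕ} (hk : 4 ≤ k)

/-- The state with bits `b`, `c`. -/
def state (b c : Bool) : Fin k := ⟨2 * b.toNat + c.toNat, by cases b <;> cases c <;> simp <;> omega⟩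

/-- The last bit of a state. -/
def lastBit (x : Fin k) : Bool := decide (x.val % 2 = 1)

lemma lastBit_state (b c : Bool) : lastBit (state hk b c) = c := by
  cases b <;> cases c <;> simp [lastBit, state]

/-- The last bit becomes the first one, up to a flip, and a new last bit is appended. -/
def step (x : Fin k) (w : Bool × Bool) : Fin k := state hk (xor (lastBit x) w.1) w.2

/-- The kernel of the random map `step`. -/
noncomputable def kernel (p : unitInterval) : Kernel (Fin k) (Fin k) :=
  Kernel.ofFunOfCountable fun x => (bitLaw p).map (step hk x)

lemma kernel_apply (p : unitInterval) (x : Fin k) :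
    kernel hk p x = (bitLaw p).map (step hk x) := rfl

instance (p : unitInterval) : IsMarkovKernel (kernel hk p) :=
  ⟨fun x => by
    rw [kernel_apply]
    exact Measure.isProbabilityMeasure_map (Measurable.of_discrete).aemeasurable⟩

lemma kerMean_kernel (p : unitInterval) (g : Fin k → ℝ) (x : Fin k) :
    kerMean (kernel hk p) g x = ∑ w, bitWeight p w * g (step hk x w) := by
  rw [kerMean, kernel_apply, integral_map (Measurable.of_discrete).aemeasurable
    (Measurable.of_discrete).aestronglyMeasurable, integral_bitLaw]

lemma real_kernel (p : unitInterval) (x : Fin k) (A : Set (Fin k)) :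
    (kernel hk p x).real A = ∑ w, bitWeight p w * A.indicator (fun _ => 1) (step hk x w) := by
  rw [← kerMean_kernel, kerMean, integral_indicator (MeasurableSet.of_discrete)]
  simp

/-- The kernel sees only the last bit of the state. Its two possible laws differ on A by (1 - p)/2
times a difference of two sums, each in [0, 2]. -/
lemma mdDelta_kernel (p : unitInterval) : mdDelta (kernel hk p) = 1 - p := by
  have h0 := p.2.1
  have h1 := p.2.2
  refine le_antisymm (mdDelta_le _ (by linarith) fun x y A _ => ?_) ?_
  · rw [real_kernel, real_kernel, sum_bool_prod, sum_bool_prod]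
    have hA : ∀ z, 0 ≤ A.indicator (fun _ => (1 : ℝ)) z ∧ A.indicator (fun _ => (1 : ℝ)) z ≤ 1 :=
      fun z => ⟨Set.indicator_nonneg (fun _ _ => zero_le_one) _,
        Set.indicator_le_self' (fun _ _ => zero_le_one) _⟩
    simp only [bitWeight, cond_true, cond_false, step]
    have a1 := hA (state hk true true)
    have a2 := hA (state hk true false)
    have a3 := hA (state hk false true)
    have a4 := hA (state hk false false)
    cases lastBit x <;> cases lastBit y <;>
      simp only [Bool.xor_true, Bool.xor_false, Bool.not_true, Bool.not_false] <;>
      generalize A.indicator (fun _ => (1 : ℝ)) (state hk true true) = z1 at * <;>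
      generalize A.indicator (fun _ => (1 : ℝ)) (state hk true false) = z2 at * <;>
      generalize A.indicator (fun _ => (1 : ℝ)) (state hk false true) = z3 at * <;>
      generalize A.indicator (fun _ => (1 : ℝ)) (state hk false false) = z4 at * <;>
      have m1 : 0 ≤ (1 - (p : ℝ)) * (2 - (z1 + z2) + (z3 + z4)) :=
        mul_nonneg (by linarith) (by linarith [a1.2, a2.2, a3.1, a4.1]) <;>
      have m2 : 0 ≤ (1 - (p : ℝ)) * (2 - (z3 + z4) + (z1 + z2)) :=
        mul_nonneg (by linarith) (by linarith [a1.1, a2.1, a3.2, a4.2]) <;>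
      rw [abs_le] <;> constructor <;> linarith
  -- States 0 and 1 have different last bits, and {0, 1} is the event that the new first bit is
  -- `false`; its probabilities are 1 - p/2 and p/2.
  · have h := abs_sub_le_mdDelta (kernel hk p) (⟨0, by omega⟩ : Fin k) ⟨1, by omega⟩
      (A := {y | y.val < 2}) MeasurableSet.of_discrete
    rw [real_kernel, real_kernel, sum_bool_prod, sum_bool_prod] at h
    simp [bitWeight, step, lastBit, state, Set.indicator] at h
    linarith [le_abs_self (1 - (p : ℝ) / 2 - (p : ℝ) / 2)]

/-- The second step uses only the last bit produced by the first, which is fresh and independent of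
the starting state. -/
lemma mdDelta_kernel_comp (p : unitInterval) : mdDelta (kernel hk p ∘ₖ kernel hk p) = 0 := by
  refine le_antisymm (mdDelta_le _ le_rfl fun x y A hA => ?_) (mdDelta_nonneg _)
  have hb : BddMeas (A.indicator fun _ => (1 : ℝ)) :=
    ⟨Measurable.of_discrete, 1, fun z => by
      by_cases hz : z ∈ A <;> simp [hz]⟩
  have e : ∀ x, ((kernel hk p ∘ₖ kernel hk p) x).real A
      = kerMean (kernel hk p ∘ₖ kernel hk p) (A.indicator fun _ => (1 : ℝ)) x := fun x => by
    rw [kerMean, integral_indicator hA]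
    simp
  rw [e, e, ← kerMean_kerMean _ _ hb, ← kerMean_kerMean _ _ hb]
  simp only [kerMean_kernel, step, lastBit_state]
  simp

lemma alphaOne_kernel (p : unitInterval) {n : ℕ} (hn : 2 ≤ n) :
    alphaOne n (fun _ => kernel hk p) = p := by
  have : Nonempty (Set.Icc 1 (n - 1)) := ⟨⟨1, by simp; omega⟩⟩
  rw [alphaOne, ciInf_const, mdAlpha, mdDelta_kernel]
  ring

lemma alphaTwo_kernel (p : unitInterval) {n : ℕ} (hn : 3 ≤ n) :
    alphaTwo n (fun _ => kernel hk p) = 1 := by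
  have : Nonempty (Set.Icc 1 (n - 2)) := ⟨⟨1, by simp; omega⟩⟩
  rw [alphaTwo, ciInf_const, mdAlpha, mdDelta_kernel_comp]
  ring

/-- The law of independent pairs of bits. -/
noncomputable def bitsLaw (p : unitInterval) : Measure (ℕ → Bool × Bool) :=
  Measure.infinitePi fun _ => bitLaw p

instance (p : unitInterval) : IsProbabilityMeasure (bitsLaw p) := by
  unfold bitsLaw; infer_instance

/-- The stationary chain driven by the bits `ω`. -/
def chain (i : ℕ) (ω : ℕ → Bool × Bool) : Fin k :=
  state hk (xor (ω (i - 1)).2 (ω i).1) (ω i).2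

lemma chain_succ (i : ℕ) (ω : ℕ → Bool × Bool) :
    chain hk (i + 1) ω = step hk (chain hk i ω) (ω (i + 1)) := by
  rw [step, chain, chain, lastBit_state]
  rfl

lemma measurable_chain (i : ℕ) : Measurable (chain hk i) := by
  have h : Measurable fun w : (Bool × Bool) × (Bool × Bool) =>
    (state hk (xor w.1.2 w.2.1) w.2.2 : Fin k) := Measurable.of_discrete
  have h2 : Measurable fun ω : ℕ → Bool × Bool => (ω (i - 1), ω i) :=
    (measurable_pi_apply _).prodMk (measurable_pi_apply _)
  exact h.comp h2

lemma history_chain_le (i : ℕ) : history (chain hk) i ≤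
    MeasurableSpace.comap (fun (ω : ℕ → Bool × Bool) (j : Finset.range (i + 1)) => ω j)
      inferInstance := by
  refine iSup₂_le fun j hj => ?_
  have hj' := Finset.mem_Icc.1 hj
  have h : Measurable fun w : (Bool × Bool) × (Bool × Bool) =>
    (state hk (xor w.1.2 w.2.1) w.2.2 : Fin k) := Measurable.of_discrete
  have h2 : Measurable fun w : Finset.range (i + 1) → Bool × Bool =>
      (w ⟨j - 1, by simp; omega⟩, w ⟨j, by simp; omega⟩) :=
    (measurable_pi_apply _).prodMk (measurable_pi_apply _)
  exact ((h.comp h2).comp (comap_measurable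
    (fun (ω : ℕ → Bool × Bool) (j : Finset.range (i + 1)) => ω j))).comap_le

lemma integral_bitsLaw (p : unitInterval) (i : ℕ) (g : Bool × Bool → ℝ) :
    ∫ ω, g (ω i) ∂(bitsLaw p) = ∑ w, bitWeight p w * g w := by
  have hmp : MeasurePreserving (fun ω : ℕ → Bool × Bool => ω i) (bitsLaw p) (bitLaw p) :=
    measurePreserving_eval_infinitePi (fun _ : ℕ => bitLaw p) i
  rw [← integral_bitLaw, ← hmp.map_eq, integral_map hmp.measurable.aemeasurable
    (Measurable.of_discrete).aestronglyMeasurable]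

lemma condExp_bits (p : unitInterval) (i : ℕ) (g : Bool × Bool → ℝ) :
    (bitsLaw p)[fun ω => g (ω (i + 1)) | history (chain hk) i]
      =ᵐ[bitsLaw p] fun _ => ∑ w, bitWeight p w * g w := by
  have hind : iIndepFun (fun (j : ℕ) (ω : ℕ → Bool × Bool) => ω j) (bitsLaw p) :=
    iIndepFun_infinitePi (X := fun _ w => w) fun _ => measurable_id
  have h1 := hind.indepFun_finset {i + 1} (Finset.range (i + 1)) (by simp)
    (fun j => measurable_pi_apply j)
  rw [← integral_bitsLaw p (i + 1) g]
  refine condExp_indep_eq (m₁ := MeasurableSpace.comap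
    (fun (ω : ℕ → Bool × Bool) (j : ({i + 1} : Finset ℕ)) => ω j) inferInstance) ?_ ?_ ?_
    (indep_of_indep_of_le_right h1 (history_chain_le hk i))
  · exact Measurable.comap_le (by fun_prop)
  · exact iSup₂_le fun j _ => (measurable_chain hk j).comap_le
  · have hg : Measurable fun w : ({i + 1} : Finset ℕ) → Bool × Bool => g (w ⟨i + 1, by simp⟩) :=
      (Measurable.of_discrete (f := g)).comp (measurable_pi_apply _)
    exact (hg.comp (comap_measurable
      (fun (ω : ℕ → Bool × Bool) (j : ({i + 1} : Finset ℕ)) => ω j))).stronglyMeasurable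

lemma bddMeas_indicator {α : Type*} [MeasurableSpace α] [DiscreteMeasurableSpace α] (A : Set α) :
    BddMeas (A.indicator fun _ => (1 : ℝ)) :=
  ⟨Measurable.of_discrete, 1, fun z => by by_cases hz : z ∈ A <;> simp [hz]⟩

/-- Splitting according to the current state separates a factor known from the past from one
depending only on the fresh bits, so that conditioning acts on each factor. -/
lemma indicator_eq_sum (A : Set (Fin k)) (i : ℕ) (ω : ℕ → Bool × Bool) :
    (chain hk (i + 1) ⁻¹' A).indicator (fun _ => (1 : ℝ)) ω
      = ∑ x : Fin k, ({x} : Set (Fin k)).indicator (fun _ => (1 : ℝ)) (chain hk i ω)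
          * (step hk x ⁻¹' A).indicator (fun _ => (1 : ℝ)) (ω (i + 1)) := by
  rw [Finset.sum_eq_single (chain hk i ω)]
  · rw [Set.indicator_of_mem (Set.mem_singleton _), one_mul]
    have h : ω ∈ chain hk (i + 1) ⁻¹' A ↔ ω (i + 1) ∈ step hk (chain hk i ω) ⁻¹' A := by
      rw [Set.mem_preimage, Set.mem_preimage, chain_succ]
    by_cases hc : ω ∈ chain hk (i + 1) ⁻¹' A
    · rw [Set.indicator_of_mem hc, Set.indicator_of_mem (h.1 hc)]
    · rw [Set.indicator_of_notMem hc, Set.indicator_of_notMem (h.not.1 hc)]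
  · intro x _ hx
    simp [Set.indicator, hx.symm]
  · simp

lemma condExp_term (p : unitInterval) {i : ℕ} (hi : 1 ≤ i) (x : Fin k) (g : Bool × Bool → ℝ) :
    (bitsLaw p)[fun ω => ({x} : Set (Fin k)).indicator (fun _ => (1 : ℝ)) (chain hk i ω)
        * g (ω (i + 1)) | history (chain hk) i]
      =ᵐ[bitsLaw p] fun ω => ({x} : Set (Fin k)).indicator (fun _ => (1 : ℝ)) (chain hk i ω)
          * ∑ w, bitWeight p w * g w := by
  have hb1 := (bddMeas_indicator ({x} : Set (Fin k))).comp (measurable_chain hk i)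
  have hg : BddMeas g := ⟨Measurable.of_discrete, ∑ w, |g w|, fun w =>
    Finset.single_le_sum (f := fun w => |g w|) (fun _ _ => abs_nonneg _) (Finset.mem_univ w)⟩
  have hb2 : BddMeas fun ω : ℕ → Bool × Bool => g (ω (i + 1)) := hg.comp (measurable_pi_apply _)
  have hm : Measurable[history (chain hk) i] fun ω =>
      ({x} : Set (Fin k)).indicator (fun _ => (1 : ℝ)) (chain hk i ω) :=
    (bddMeas_indicator ({x} : Set (Fin k))).1.comp
      (IsMarkovChain.measurable_history (X := chain hk) (i := i) hi le_rfl)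
  refine (condExp_mul_of_stronglyMeasurable_left hm.stronglyMeasurable
    ((hb1.mul hb2).integrable _) (hb2.integrable _)).trans ?_
  filter_upwards [condExp_bits hk p i g] with ω hω
  rw [Pi.mul_apply, hω]

lemma condExp_chain_succ (p : unitInterval) {i : ℕ} (hi : 1 ≤ i) (A : Set (Fin k)) :
    (bitsLaw p)[(chain hk (i + 1) ⁻¹' A).indicator (fun _ => (1 : ℝ)) | history (chain hk) i]
      =ᵐ[bitsLaw p] fun ω => (kernel hk p (chain hk i ω)).real A := by
  have e : (chain hk (i + 1) ⁻¹' A).indicator (fun _ => (1 : ℝ))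
      = ∑ x : Fin k, fun ω => ({x} : Set (Fin k)).indicator (fun _ => (1 : ℝ)) (chain hk i ω)
          * (step hk x ⁻¹' A).indicator (fun _ => (1 : ℝ)) (ω (i + 1)) := by
    ext ω
    rw [Finset.sum_apply, indicator_eq_sum]
  have hb : ∀ x : Fin k, BddMeas fun ω : ℕ → Bool × Bool =>
      ({x} : Set (Fin k)).indicator (fun _ => (1 : ℝ)) (chain hk i ω)
          * (step hk x ⁻¹' A).indicator (fun _ => (1 : ℝ)) (ω (i + 1)) := fun x =>
    ((bddMeas_indicator _).comp (measurable_chain hk i)).mul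
      ((bddMeas_indicator _).comp (measurable_pi_apply (i + 1)))
  rw [e]
  refine (condExp_finsetSum (fun x _ => (hb x).integrable _) (history (chain hk) i)).trans ?_
  filter_upwards [ae_all_iff.2 fun x : Fin k =>
    condExp_term hk p hi x ((step hk x ⁻¹' A).indicator fun _ => (1 : ℝ))] with ω hω
  rw [Finset.sum_apply, Finset.sum_congr rfl fun x _ => hω x, real_kernel,
    Finset.sum_eq_single (chain hk i ω)]
  · rw [Set.indicator_of_mem (Set.mem_singleton _), one_mul]
    rfl
  · intro x _ hx
    simp [Set.indicator, hx.symm]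
  · simp

lemma isMarkovChain_chain (p : unitInterval) (n : ℕ) :
    IsMarkovChain (bitsLaw p) n ((bitsLaw p).map (chain hk 1)) (fun _ => kernel hk p)
      (chain hk) where
  measurable i _ := measurable_chain hk i
  initial := rfl
  transition _ hi _ A _ := condExp_chain_succ hk p hi A

/-- The last bit as a real number. -/
def bitValue (x : Fin k) : ℝ := bif lastBit x then 1 else 0

lemma abs_bitValue_le (x : Fin k) : |bitValue x| ≤ 1 := by
  unfold bitValue
  cases lastBit x <;> simp

lemma variance_bitValue (p : unitInterval) (i : ℕ) :
    Var[fun ω => bitValue (chain hk i ω); bitsLaw p] = 1 / 4 := by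
  have hb : BddMeas (bitValue (k := k)) := ⟨Measurable.of_discrete, 1, abs_bitValue_le⟩
  have e : ∀ ω : ℕ → Bool × Bool, bitValue (chain hk i ω) = bif (ω i).2 then 1 else 0 := fun ω => by
    rw [bitValue, chain, lastBit_state]
  rw [variance_eq_integral (hb.comp (measurable_chain hk i)).1.aemeasurable]
  simp_rw [e]
  rw [integral_bitsLaw p i fun w => bif w.2 then 1 else 0, sum_bool_prod]
  rw [integral_bitsLaw p i fun w => ((bif w.2 then 1 else 0) - _) ^ 2, sum_bool_prod]
  simp only [bitWeight, cond_true, cond_false]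
  ring

/-- The flipping parameter `n ^ (- 1 / 3)`. -/
noncomputable def param (n : ℕ) : unitInterval :=
  ⟨(n : ℝ) ^ (-(1 / 3) : ℝ), by positivity, by
    rcases Nat.eq_zero_or_pos n with rfl | hn
    -- At n = 0 the negative power of 0 is 0 by convention, which still lies in [0, 1].
    · rw [Nat.cast_zero, Real.zero_rpow (by norm_num)]
      exact zero_le_one
    · exact Real.rpow_le_one_of_one_le_of_nonpos (by exact_mod_cast hn) (by norm_num)⟩

lemma param_coe (n : ℕ) : (param n : ℝ) = (n : ℝ) ^ (-(1 / 3) : ℝ) := rfl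

lemma tendsto_dobrushin :
    Tendsto (fun n : ℕ => (n : ℝ) ^ (1 / 3 : ℝ) * alphaOne n (fun _ => kernel hk (param n))) atTop
      (𝓝 1) := by
  refine tendsto_const_nhds.congr' ?_
  filter_upwards [eventually_ge_atTop 2] with n hn
  rw [alphaOne_kernel hk _ hn, param_coe, ← Real.rpow_add (by exact_mod_cast (by omega : 0 < n))]
  norm_num

lemma tendsto_two_step :
    Tendsto (fun n : ℕ => (n : ℝ) * alphaOne n (fun _ => kernel hk (param n)) *
      (alphaTwo n (fun _ => kernel hk (param n))) ^ 2) atTop atTop := by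
  refine ((tendsto_rpow_atTop (y := 2 / 3) (by norm_num)).comp
    tendsto_natCast_atTop_atTop).congr' ?_
  filter_upwards [eventually_ge_atTop 3] with n hn
  have hpos : (0 : ℝ) < n := by exact_mod_cast (by omega : 0 < n)
  rw [alphaOne_kernel hk _ (by omega), alphaTwo_kernel hk _ hn, param_coe, one_pow, mul_one,
    Function.comp_apply]
  conv_rhs => rw [← Real.rpow_one (n : ℝ), ← Real.rpow_mul hpos.le, ← Real.rpow_add hpos]
  norm_num

end LazyShift

theorem mainTheorem2 :
    -- the central limit theorem
    (∀ {S : Type*} [MeasurableSpace S]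
      {Ω : ℕ → Type*} [∀ n, MeasurableSpace (Ω n)]
      (P : ∀ n, Measure (Ω n)) [∀ n, IsProbabilityMeasure (P n)]
      (μ : ℕ → Measure S) (κ : ℕ → ℕ → Kernel S S) [∀ n i, IsMarkovKernel (κ n i)]
      (X : ∀ n, ℕ → Ω n → S) (f : ℕ → ℕ → S → ℝ) (C : ℕ → ℝ) (c : ℝ),
      (∀ n, 1 ≤ n → IsMarkovChain (P n) n (μ n) (κ n) (X n)) →
      (∀ n, ∀ i ∈ Finset.Icc 1 n, Measurable (f n i)) →
      (∀ n, ∀ i ∈ Finset.Icc 1 n, ∀ x, |f n i x| ≤ C n) →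
      BddAbove (Set.range C) →
      0 < c →
      (∀ n, ∀ i ∈ Finset.Icc 1 n, c ≤ Var[fun ω => f n i (X n i ω); P n]) →
      Tendsto (fun n : ℕ => (n : ℝ) * alphaOne n (κ n) * (alphaTwo n (κ n)) ^ 2) atTop atTop →
      TendstoInDistribution
        (fun n ω => (chainSum n (f n) (X n) ω - ∫ ω', chainSum n (f n) (X n) ω' ∂(P n)) /
          √(Var[chainSum n (f n) (X n); P n]))
        atTop (id : ℝ → ℝ) P (gaussianReal 0 1)) ∧
    -- on every state space with at least four points there are time-homogeneous chains which
    -- satisfy all the hypotheses above, while Dobrushin's condition fails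
    (∀ k : ℕ, 4 ≤ k →
      ∃ (Ω : ℕ → Type) (_ : ∀ n, MeasurableSpace (Ω n))
        (P : ∀ n, Measure (Ω n)) (_ : ∀ n, IsProbabilityMeasure (P n))
        (μ : ℕ → Measure (Fin k)) (κ : ℕ → Kernel (Fin k) (Fin k))
        (_ : ∀ n, IsMarkovKernel (κ n))
        (X : ∀ n, ℕ → Ω n → Fin k) (f : ℕ → ℕ → Fin k → ℝ) (C : ℕ → ℝ) (c : ℝ),
        (∀ n, 1 ≤ n → IsMarkovChain (P n) n (μ n) (fun _ => κ n) (X n)) ∧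
        (∀ n, ∀ i ∈ Finset.Icc 1 n, Measurable (f n i)) ∧
        (∀ n, ∀ i ∈ Finset.Icc 1 n, ∀ x, |f n i x| ≤ C n) ∧
        BddAbove (Set.range C) ∧
        0 < c ∧
        (∀ n, ∀ i ∈ Finset.Icc 1 n, c ≤ Var[fun ω => f n i (X n i ω); P n]) ∧
        Tendsto (fun n : ℕ => (n : ℝ) * alphaOne n (fun _ => κ n) *
          (alphaTwo n (fun _ => κ n)) ^ 2) atTop atTop ∧
        (∃ a : ℝ, 0 < a ∧
          Tendsto (fun n : ℕ => (n : ℝ) ^ (1 / 3 : ℝ) * alphaOne n (fun _ => κ n)) atTop (𝓝 a)) ∧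
        ¬ Tendsto (fun n : ℕ => (n : ℝ) ^ (1 / 3 : ℝ) * alphaOne n (fun _ => κ n)) atTop atTop) := by
  refine ⟨?_, fun k hk => ?_⟩
  · intro S _ Ω _ P _ μ κ _ X f C c hX hf hC hCb hc hvar hlim
    exact tendstoInDistribution_chainSum P μ κ X f C c hX hf hC hCb hc hvar hlim
  · refine ⟨fun _ => ℕ → Bool × Bool, fun _ => inferInstance,
      fun n => LazyShift.bitsLaw (LazyShift.param n), fun n => inferInstance,
      fun n => (LazyShift.bitsLaw (LazyShift.param n)).map (LazyShift.chain hk 1),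
      fun n => LazyShift.kernel hk (LazyShift.param n), fun n => inferInstance,
      fun _ => LazyShift.chain hk, fun _ _ => LazyShift.bitValue, fun _ => 1, 1 / 4,
      fun n _ => LazyShift.isMarkovChain_chain hk _ n, fun _ _ _ => Measurable.of_discrete,
      fun _ _ _ => LazyShift.abs_bitValue_le, ⟨1, by rintro _ ⟨_, rfl⟩; exact le_rfl⟩, by norm_num,
      fun n i _ => (LazyShift.variance_bitValue hk _ i).ge, LazyShift.tendsto_two_step hk,
      ⟨1, one_pos, LazyShift.tendsto_dobrushin hk⟩,
      not_tendsto_atTop_of_tendsto_nhds (LazyShift.tendsto_dobrushin hk)⟩
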